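/- Let $c>0$, $a_1<a_2$, $d=a_2-a_1$. Let $H$ be the Heaviside function with $H(0)=\tfrac12$, let $\operatorname{sgn}0=0$, and let $H_S^-(x)=H(x-a_1)H(a_2-x)$ be the characteristic function of $(a_1,a_2)$ (equal to $\tfrac12$ at the endpoints). Let $G$ be locally integrable on $[a_1,a_2]\times[0,\infty)$ and let $u$ be a classical solution of $$u_{xx}-c^{-2}u_{tt}=G(x,t),\qquad a_1<x<a_2,\ t>0,$$ with initial data $u(x,0)=u_0(x)$ for $a_1\le x\le a_2$ and $u_t(x,0)=\dot u_0(x)$ for $a_1<x<a_2$ (the latter where no wave front starts). Classical solution means the following. $u$ is continuous on $[a_1,a_2]\times[0,\infty)$. There are closed, at most countable sets $A,B\subset\mathbb R$ such that, off the wave fronts $x-ct=b$ ($b\in A$, moving to the right, $n=1$) and $x+ct=b$ ($b\in B$, moving to the left, $n=-1$), $u$ is $C^1$ up to the boundary of $[a_1,a_2]\times[0,\infty)$, is $C^2$ in the interior and satisfies the equation there. On the fronts, at interior points where two fronts of different direction do not cross, the Hadamard condition $[u_t+c\,n\,u_x]=0$ holds, i.e. $u_t+c\,n\,u_x$ has one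 and the same finite limit from both sides (the condition $[u]=0$ is contained in the continuity of $u$). The boundary conditions may be of Dirichlet, Neumann or mixed type. Assume that $\dot u_0$ is integrable on $[a_1,a_2]$ and that $u_x(a_1,\cdot)$ and $u_x(a_2,\cdot)$ are integrable on every interval $[0,T]$. Put $\hat u(x,t)=u(x,t)\,H_S^-(x)\,H(t)$. Then for all $x\in\mathbb R$ and all $t>0$ $$ \begin{aligned} 2\hat u(x,t)={}&c\Big\{H(ct-|x-a_2|)\int_{|x-a_2|/c}^{t}u_x(a_2,t-\tau)\,d\tau-H(ct-|x-a_1|)\int_{|x-a_1|/c}^{t}u_x(a_1,t-\tau)\,d\tau\Big\}\\ &+\operatorname{sgn}(x-a_1)\,H(ct-|x-a_1|)\,u\Big(a_1,t-\frac{|x-a_1|}{c}\Big)-\operatorname{sgn}(x-a_2)\,H(ct-|x-a_2|)\,u\Big(a_2,t-\frac{|x-a_2|}{c}\Big)\\ &+c^{-1}\int_{a_1}^{a_2}\dot u_0(y)\,H(ct-|x-y|)\,dy+u_0(x+ct)H_S^-(x+ct)+u_0(x-ct)H_S^-(x-ct)\\ &-c\int_0^t\int_{a_1}^{a_2}H\big(c(t-\tau)-|x-y|\big)\,G(y,\tau)\,dy\,d\tau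 , \end{aligned} $$ where products with a vanishing factor $H$ or $H_S^-$ are read as $0$, and the last term is absent when $G=0$. Moreover, the boundary values of $u$ and $u_x$ satisfy, for all $t>0$, the functional equations with delayed argument $$ \begin{aligned} u(a_1,t)={}&cH(ct-d)\int_{d/c}^{t}u_x(a_2,t-\tau)\,d\tau-c\int_0^t u_x(a_1,\tau)\,d\tau+H(ct-d)\,u\Big(a_2,t-\frac dc\Big)\\ &+c^{-1}\int_{a_1}^{a_2}\dot u_0(y)H(ct-|a_1-y|)\,dy+u_0(a_1+ct)H(d-ct)\\ &-c\int_0^t\int_{a_1}^{a_2}H\big(c(t-\tau)-|a_1-y|\big)G(y,\tau)\,dy\,d\tau,\\ u(a_2,t)={}&c\int_0^t u_x(a_2,\tau)\,d\tau-cH(ct-d)\int_{d/c}^{t}u_x(a_1,t-\tau)\,d\tau+H(ct-d)\,u\Big(a_1,t-\frac dc\Big)\\ &+c^{-1}\int_{a_1}^{a_2}\dot u_0(y)H(ct-|a_2-y|)\,dy+u_0(a_2-ct)H(d-ct)\\ &-c\int_0^t\int_{a_1}^{a_2}H\big(c(t-\tau)-|a_2-y|\big)G(y,\tau)\,dy\,d\tau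 . \end{aligned} $$ -/

import Mathlib

open Set Filter Topology MeasureTheory

namespace Wave1D

/-- The Heaviside function, with value `1/2` at the origin. -/
noncomputable def heaviside (s : ℝ) : ℝ := if s < 0 then 0 else if s = 0 then 1 / 2 else 1

/-- The characteristic function of the interval `(a₁, a₂)`, equal to `1/2` at the two endpoints. -/
noncomputable def charInterval (a₁ a₂ x : ℝ) : ℝ := heaviside (x - a₁) * heaviside (a₂ - x)

/-- The function `u` cut off by the characteristic function of the space-time cylinder
`(a₁, a₂) × (0, ∞)`. -/
noncomputable def cutoff (a₁ a₂ : ℝ) (u : ℝ → ℝ → ℝ) (x t : ℝ) : ℝ :=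
  u x t * charInterval a₁ a₂ x * heaviside t

/-- The closed space-time cylinder `[a₁, a₂] × [0, ∞)`; points are pairs `(x, t)`. -/
def cylinder (a₁ a₂ : ℝ) : Set (ℝ × ℝ) := Icc a₁ a₂ ×ˢ Ici 0

/-- The open space-time cylinder `(a₁, a₂) × (0, ∞)`. -/
def openCylinder (a₁ a₂ : ℝ) : Set (ℝ × ℝ) := Ioo a₁ a₂ ×ˢ Ioi 0

/-- The partial derivative `u_x`; it is one-sided at `x = a₁` and `x = a₂`. -/
noncomputable def dx (a₁ a₂ : ℝ) (u : ℝ → ℝ → ℝ) (x t : ℝ) : ℝ :=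
  derivWithin (fun y => u y t) (Icc a₁ a₂) x

/-- The partial derivative `u_t`; it is one-sided at `t = 0`. -/
noncomputable def dt (u : ℝ → ℝ → ℝ) (x t : ℝ) : ℝ :=
  derivWithin (fun s => u x s) (Ici 0) t

/-- The union of the wave fronts. In one space dimension the wave fronts run along characteristic
lines: those moving to the right lie on the lines `x - c t = b` with `b ∈ A`, those moving to the
left lie on the lines `x + c t = b` with `b ∈ B`. -/
def fronts (c : ℝ) (A B : Set ℝ) : Set (ℝ × ℝ) :=
  {q | q.1 - c * q.2 ∈ A ∨ q.1 + c * q.2 ∈ B}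

/-- `u` is a classical solution of `u_xx - c⁻² u_tt = G` on `[a₁, a₂] × [0, ∞)` with at most
countably many wave fronts, given by `A` (moving to the right) and `B` (moving to the left).
The Hadamard conditions on the fronts are `[u] = 0`, which is part of the continuity of `u`, and
`[u_t + c n u_x] = 0` with `n = 1` on `A`-fronts and `n = -1` on `B`-fronts. The latter says that
`u_t + c n u_x` has one and the same limit from the two sides of the front; it is required at the
points where a front does not meet a front of the other family. -/
structure IsClassicalSolution (c a₁ a₂ : ℝ) (G : ℝ → ℝ → ℝ) (A B : Set ℝ)
    (u : ℝ → ℝ → ℝ) : Prop where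
  closed_right : IsClosed A
  countable_right : A.Countable
  closed_left : IsClosed B
  countable_left : B.Countable
  continuousOn : ContinuousOn (Function.uncurry u) (cylinder a₁ a₂)
  contDiffOn_one : ContDiffOn ℝ 1 (Function.uncurry u) (cylinder a₁ a₂ \ fronts c A B)
  contDiffOn_two : ContDiffOn ℝ 2 (Function.uncurry u) (openCylinder a₁ a₂ \ fronts c A B)
  equation : ∀ x t : ℝ, (x, t) ∈ openCylinder a₁ a₂ \ fronts c A B →
    iteratedDeriv 2 (fun y => u y t) x - 1 / c ^ 2 * iteratedDeriv 2 (fun s => u x s) t = G x t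
  hadamard_right : ∀ x t : ℝ, (x, t) ∈ openCylinder a₁ a₂ → x - c * t ∈ A → x + c * t ∉ B →
    ∃ L : ℝ, Tendsto (fun q : ℝ × ℝ => dt u q.1 q.2 + c * dx a₁ a₂ u q.1 q.2)
      (𝓝[cylinder a₁ a₂ \ fronts c A B] (x, t)) (𝓝 L)
  hadamard_left : ∀ x t : ℝ, (x, t) ∈ openCylinder a₁ a₂ → x + c * t ∈ B → x - c * t ∉ A →
    ∃ L : ℝ, Tendsto (fun q : ℝ × ℝ => dt u q.1 q.2 - c * dx a₁ a₂ u q.1 q.2)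
      (𝓝[cylinder a₁ a₂ \ fronts c A B] (x, t)) (𝓝 L)

/-- The initial conditions `u(x,0) = u₀(x)` on `[a₁, a₂]` and `u_t(x,0) = v₀(x)` on `(a₁, a₂)`;
the second one is required where no front starts. -/
structure HasInitialData (c a₁ a₂ : ℝ) (A B : Set ℝ) (u : ℝ → ℝ → ℝ) (u₀ v₀ : ℝ → ℝ) :
    Prop where
  value : ∀ x ∈ Icc a₁ a₂, u x 0 = u₀ x
  velocity : ∀ x ∈ Ioo a₁ a₂, (x, (0 : ℝ)) ∉ fronts c A B → dt u x 0 = v₀ x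

end Wave1D

/-! Along a right-moving characteristic `y - c τ = s` the combination `u_t - c u_x` has derivative
`-c G` in `y`. If `s ∉ A`, the only fronts met are left-moving ones, and across these the Hadamard
condition makes `u_t - c u_x` continuous. Hence its value at a point equals its value where the
characteristic enters the cylinder, minus `c` times the integral of `G` along the line
(`flux_sub_flux`). At the entry point the value is known from the data: it is `-c` times the
derivative of `leftData`, call this function `F` (`hasDerivAt_leftData`).

Now move along a left-moving characteristic `x + c t = η`, with `s = x - c t` as parameter. There `2
u - F` has as derivative the integral of `G` over a slice of the backward cone, so `2 u - F + c P`
is constant, `P` being the integral of `G` over the cone (`leftDefect_eq`). Only countably many `s`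
and `η` are bad; the fundamental theorem of calculus off a countable set, and continuity, take care
of them.

Reflection in `x` gives the mirror statement with a function `F'` built from the right-hand data.
Then `2 u - F - F' + c P - c⁻¹ ∫ v₀` is constant along both families of characteristics and vanishes
at `t = 0`. Following characteristics back from wall to wall, one reaches the initial line in
finitely many steps, so it vanishes identically (`two_mul_eq`).

What remains is bookkeeping. `sideTerm` rewrites `F` and `F'` with Heaviside factors, the half
values matching on the fronts from the corners; outside the interval the terms cancel
(`two_mul_cutoff`). The delay equations are the representation at the two endpoints. -/

namespace Wave1D

/-! ### Characteristic coordinates and integrals over the backward cone. -/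

theorem map_shear_volume {c : ℝ} (hc : 0 < c) :
    Measure.map (fun p : ℝ × ℝ => (p.2, (p.2 - p.1) / c)) volume
      = ENNReal.ofReal c • (volume : Measure (ℝ × ℝ)) := by
  have hdet : LinearMap.det (Matrix.toLin (Module.Basis.finTwoProd ℝ) (Module.Basis.finTwoProd ℝ)
      !![0, 1; -1 / c, 1 / c]) = 1 / c := by
    rw [LinearMap.det_toLin, Matrix.det_fin_two_of]; ring
  have h := Measure.map_linearMap_addHaar_eq_smul_addHaar (volume : Measure (ℝ × ℝ))
    (f := Matrix.toLin (Module.Basis.finTwoProd ℝ) (Module.Basis.finTwoProd ℝ)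
      !![0, 1; -1 / c, 1 / c]) (by rw [hdet]; positivity)
  rw [hdet] at h
  have e : (fun p : ℝ × ℝ => (p.2, (p.2 - p.1) / c)) = ⇑(Matrix.toLin (Module.Basis.finTwoProd ℝ)
      (Module.Basis.finTwoProd ℝ) !![0, 1; -1 / c, 1 / c]) := by
    ext p
    · simp [Matrix.toLin_finTwoProd_apply]
    · simp [Matrix.toLin_finTwoProd_apply]; ring
  rw [e, h]
  congr 2
  rw [one_div, inv_inv, abs_of_pos hc]

theorem measurableEmbedding_shear {c : ℝ} (hc : 0 < c) :
    MeasurableEmbedding (fun p : ℝ × ℝ => (p.2, (p.2 - p.1) / c)) := by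
  let e : (ℝ × ℝ) ≃ₜ (ℝ × ℝ) :=
    { toFun := fun p => (p.2, (p.2 - p.1) / c)
      invFun := fun q => (q.1 - c * q.2, q.1)
      left_inv := fun p => by ext <;> simp; field_simp; ring
      right_inv := fun q => by ext <;> simp; field_simp
      continuous_toFun := by fun_prop
      continuous_invFun := by fun_prop }
  exact e.measurableEmbedding

theorem integrable_shear {c : ℝ} (hc : 0 < c) {Φ : ℝ × ℝ → ℝ} (hΦ : Integrable Φ) :
    Integrable (fun p : ℝ × ℝ => Φ (p.2, (p.2 - p.1) / c)) := by
  have h : Integrable Φ (Measure.map (fun p : ℝ × ℝ => (p.2, (p.2 - p.1) / c)) volume) := by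
    rw [map_shear_volume hc]; exact hΦ.smul_measure ENNReal.ofReal_ne_top
  exact ((measurableEmbedding_shear hc).integrable_map_iff).1 h

theorem integral_shear {c : ℝ} (hc : 0 < c) (Φ : ℝ × ℝ → ℝ) :
    ∫ p : ℝ × ℝ, Φ (p.2, (p.2 - p.1) / c) = c * ∫ q, Φ q := by
  have h := (measurableEmbedding_shear hc).integral_map (μ := volume) Φ
  rw [← h, map_shear_volume hc, integral_smul_measure, ENNReal.toReal_ofReal hc.le, smul_eq_mul]

/-- The backward characteristic cone, in characteristic coordinates of its apex. -/
def cone (c ξ η : ℝ) : Set (ℝ × ℝ) := {q | ξ < q.1 - c * q.2 ∧ q.1 + c * q.2 < η}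

theorem measurableSet_cone (c ξ η : ℝ) : MeasurableSet (cone c ξ η) :=
  MeasurableSet.inter
    (measurableSet_lt (f := fun _ : ℝ × ℝ => ξ) (g := fun q => q.1 - c * q.2) (by fun_prop)
      (by fun_prop))
    (measurableSet_lt (f := fun q : ℝ × ℝ => q.1 + c * q.2) (g := fun _ => η) (by fun_prop)
      (by fun_prop))

/-- The integral of `Φ` over the backward characteristic cone. -/
noncomputable def potential (c : ℝ) (Φ : ℝ × ℝ → ℝ) (ξ η : ℝ) : ℝ := ∫ q in cone c ξ η, Φ q

/-- The integral of `Φ` over the part of the line `y - c τ = s` on which `y + c τ < η`. -/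
noncomputable def slice (c : ℝ) (Φ : ℝ × ℝ → ℝ) (η s : ℝ) : ℝ :=
  ∫ y, {y : ℝ | 2 * y - s < η}.indicator (fun y => Φ (y, (y - s) / c)) y

theorem integrable_slice_aux {c : ℝ} (hc : 0 < c) {Φ : ℝ × ℝ → ℝ} (hΦ : Integrable Φ) (η : ℝ) :
    Integrable (fun p : ℝ × ℝ =>
      {y : ℝ | 2 * y - p.1 < η}.indicator (fun y => Φ (y, (y - p.1) / c)) p.2)
      (volume.prod volume) := by
  have h := (integrable_shear hc hΦ).indicator (s := {p : ℝ × ℝ | 2 * p.2 - p.1 < η})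
    (measurableSet_lt (by fun_prop) measurable_const)
  exact h

theorem integrable_slice {c : ℝ} (hc : 0 < c) {Φ : ℝ × ℝ → ℝ} (hΦ : Integrable Φ) (η : ℝ) :
    Integrable (slice c Φ η) :=
  (integrable_slice_aux hc hΦ η).integral_prod_left

theorem ae_integrable_line {c : ℝ} (hc : 0 < c) {Φ : ℝ × ℝ → ℝ} (hΦ : Integrable Φ) :
    ∀ᵐ s : ℝ, Integrable (fun y => Φ (y, (y - s) / c)) := by
  have h : Integrable (fun p : ℝ × ℝ => Φ (p.2, (p.2 - p.1) / c)) (volume.prod volume) :=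
    integrable_shear hc hΦ
  exact h.prod_right_ae

/-- Fubini in the coordinates `(s, y)` with `s = y - c τ`; the factor `c` is the Jacobian of the
shear. -/
theorem potential_eq_slice {c : ℝ} (hc : 0 < c) {Φ : ℝ × ℝ → ℝ} (hΦ : Integrable Φ) (ξ η : ℝ) :
    c * potential c Φ ξ η = ∫ s in Ioi ξ, slice c Φ η s := by
  rw [potential, ← integral_indicator (measurableSet_cone _ _ _), ← integral_shear hc]
  have h := integrable_shear hc (hΦ.indicator (measurableSet_cone c ξ η))
  have h2 := integral_prod (μ := (volume : Measure ℝ)) (ν := (volume : Measure ℝ)) _ h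
  refine h2.trans ?_
  rw [← integral_indicator measurableSet_Ioi]
  congr 1
  ext s
  by_cases hs : ξ < s
  · rw [indicator_of_mem (show s ∈ Ioi ξ from hs), slice]
    congr 1
    ext y
    have e1 : c * ((y - s) / c) = y - s := by field_simp
    by_cases hy : 2 * y - s < η
    · rw [indicator_of_mem (show y ∈ {y : ℝ | 2 * y - s < η} from hy), indicator_of_mem]
      constructor
      · simp only [e1]; linarith
      · simp only [e1]; linarith
    · rw [indicator_of_notMem (show y ∉ {y : ℝ | 2 * y - s < η} from hy), indicator_of_notMem]
      rintro ⟨_, h⟩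
      simp only [e1] at h
      exact hy (by linarith)
  · rw [indicator_of_notMem (show s ∉ Ioi ξ from hs)]
    rw [integral_eq_zero_of_ae]
    refine Eventually.of_forall fun y => ?_
    have e1 : c * ((y - s) / c) = y - s := by field_simp
    show indicator _ _ _ = _
    rw [indicator_of_notMem]; rfl
    rintro ⟨h, _⟩
    simp only [e1] at h
    exact hs (by linarith)

theorem potential_sub {c : ℝ} (hc : 0 < c) {Φ : ℝ × ℝ → ℝ} (hΦ : Integrable Φ) (ξ₁ ξ₂ η : ℝ) :
    c * potential c Φ ξ₁ η - c * potential c Φ ξ₂ η = ∫ s in ξ₁..ξ₂, slice c Φ η s := by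
  rw [potential_eq_slice hc hΦ, potential_eq_slice hc hΦ]
  exact intervalIntegral.integral_Ioi_sub_Ioi' (integrable_slice hc hΦ η).integrableOn
    (integrable_slice hc hΦ η).integrableOn

theorem volume_line_eq_zero (k b : ℝ) : volume {q : ℝ × ℝ | q.1 + k * q.2 = b} = 0 := by
  have hm : MeasurableSet {q : ℝ × ℝ | q.1 + k * q.2 = b} :=
    measurableSet_eq_fun (by fun_prop) measurable_const
  have h := Measure.measure_prod_null (μ := (volume : Measure ℝ)) (ν := (volume : Measure ℝ))
    (hm.preimage measurable_swap)
  have h3 : volume (Prod.swap ⁻¹' {q : ℝ × ℝ | q.1 + k * q.2 = b}) = 0 := by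
    refine h.2 (Eventually.of_forall fun τ => ?_)
    have : Prod.mk τ ⁻¹' (Prod.swap ⁻¹' {q : ℝ × ℝ | q.1 + k * q.2 = b}) = {b - k * τ} := by
      ext y; simp only [mem_preimage, Prod.swap_prod_mk, mem_ofPred_eq, mem_singleton_iff]
      constructor <;> intro h <;> linarith
    show volume (Prod.mk τ ⁻¹' _) = _
    rw [this]; simp
  have h4 := (Measure.measurePreserving_swap (μ := (volume : Measure ℝ))
    (ν := (volume : Measure ℝ))).measure_preimage hm.nullMeasurableSet
  exact h4.symm.trans h3

/-- Dominated convergence: for fixed `q` the indicator of the cone is locally constant in its apex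
unless `q` lies on one of the two bounding lines, which are null sets. -/
theorem continuous_potential {c : ℝ} {Φ : ℝ × ℝ → ℝ} (hΦ : Integrable Φ) :
    Continuous (fun p : ℝ × ℝ => potential c Φ p.1 p.2) := by
  rw [continuous_iff_continuousAt]
  intro p₀
  have h : ContinuousAt (fun p : ℝ × ℝ => ∫ q, (cone c p.1 p.2).indicator Φ q) p₀ := by
    refine continuousAt_of_dominated (bound := fun q => ‖Φ q‖) ?_ ?_ hΦ.norm ?_
    · exact Eventually.of_forall fun p =>
        hΦ.aestronglyMeasurable.indicator (measurableSet_cone _ _ _)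
    · exact Eventually.of_forall fun p => Eventually.of_forall fun q =>
        norm_indicator_le_norm_self _ _
    · have h1 : ∀ᵐ q : ℝ × ℝ, ¬ (q.1 + (-c) * q.2 = p₀.1) := by
        rw [ae_iff]; simpa using volume_line_eq_zero (-c) p₀.1
      have h2 : ∀ᵐ q : ℝ × ℝ, ¬ (q.1 + c * q.2 = p₀.2) := by
        rw [ae_iff]; simpa using volume_line_eq_zero c p₀.2
      filter_upwards [h1, h2] with q hq1 hq2
      have hq1' : q.1 - c * q.2 ≠ p₀.1 := fun h => hq1 (by linarith)
      have key : ∀ᶠ p in 𝓝 p₀, (cone c p.1 p.2).indicator Φ q = (cone c p₀.1 p₀.2).indicator Φ q := by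
        have e1 : ∀ᶠ p in 𝓝 p₀, (p.1 < q.1 - c * q.2 ↔ p₀.1 < q.1 - c * q.2) := by
          rcases lt_or_gt_of_ne hq1' with h | h
          · filter_upwards [continuousAt_fst.eventually (lt_mem_nhds h)] with p hp
            exact ⟨fun h' => by linarith, fun h' => by linarith⟩
          · filter_upwards [continuousAt_fst.eventually (gt_mem_nhds h)] with p hp
            exact ⟨fun _ => h, fun _ => hp⟩
        have e2 : ∀ᶠ p in 𝓝 p₀, (q.1 + c * q.2 < p.2 ↔ q.1 + c * q.2 < p₀.2) := by
          rcases lt_or_gt_of_ne hq2 with h | h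
          · filter_upwards [continuousAt_snd.eventually (lt_mem_nhds h)] with p hp
            exact ⟨fun _ => h, fun _ => hp⟩
          · filter_upwards [continuousAt_snd.eventually (gt_mem_nhds h)] with p hp
            exact ⟨fun h' => by linarith, fun h' => by linarith⟩
        filter_upwards [e1, e2] with p hp1 hp2
        have hiff : q ∈ cone c p.1 p.2 ↔ q ∈ cone c p₀.1 p₀.2 := and_congr hp1 hp2
        by_cases hm : q ∈ cone c p₀.1 p₀.2
        · rw [indicator_of_mem hm, indicator_of_mem (hiff.2 hm)]
        · rw [indicator_of_notMem hm, indicator_of_notMem (fun h => hm (hiff.1 h))]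
      exact continuousAt_const.congr (key.mono fun p hp => hp.symm)
  refine h.congr (Eventually.of_forall fun p => ?_)
  exact integral_indicator (measurableSet_cone _ _ _)

/-! ### The Heaviside kernel as the indicator of the cone. -/

theorem heaviside_of_pos {s : ℝ} (hs : 0 < s) : heaviside s = 1 := by
  simp [heaviside, hs.ne', hs.not_gt]

theorem heaviside_of_neg {s : ℝ} (hs : s < 0) : heaviside s = 0 := by
  simp [heaviside, hs]

theorem heaviside_zero : heaviside 0 = 1 / 2 := by
  simp [heaviside]

theorem heaviside_mul_ae_eq_cone_indicator (c x t τ : ℝ) (g : ℝ → ℝ) :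
    ∀ᵐ y : ℝ, heaviside (c * (t - τ) - |x - y|) * g y
      = {y : ℝ | (y, τ) ∈ cone c (x - c * t) (x + c * t)}.indicator g y := by
  have hfin : ∀ᵐ y : ℝ, y ≠ x - c * (t - τ) ∧ y ≠ x + c * (t - τ) :=
    (Measure.ae_ne volume _).and (Measure.ae_ne volume _)
  filter_upwards [hfin] with y hy
  by_cases hm : (y, τ) ∈ cone c (x - c * t) (x + c * t)
  · have hm' : x - c * t < y - c * τ ∧ y + c * τ < x + c * t := hm
    rw [indicator_of_mem (by exact hm), heaviside_of_pos, one_mul]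
    rw [sub_pos, abs_lt]
    constructor <;> linarith [hm'.1, hm'.2]
  · rw [indicator_of_notMem (by exact hm), heaviside_of_neg, zero_mul]
    by_contra hcon
    apply hm
    have h1 := abs_le.1 (not_lt.1 (fun h : c * (t - τ) < |x - y| => hcon (by linarith)))
    refine ⟨?_, ?_⟩
    · show x - c * t < y - c * τ
      rcases lt_or_eq_of_le (show x - c * (t - τ) ≤ y by linarith) with h | h
      · linarith
      · exact absurd h.symm hy.1
    · show y + c * τ < x + c * t
      rcases lt_or_eq_of_le (show y ≤ x + c * (t - τ) by linarith) with h | h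
      · linarith
      · exact absurd h hy.2

theorem integral_heaviside_eq_potential {c a₁ a₂ t : ℝ} (ha : a₁ ≤ a₂) (ht : 0 ≤ t)
    (G : ℝ → ℝ → ℝ) (x : ℝ)
    (hΦ : Integrable ((Icc a₁ a₂ ×ˢ Icc 0 t).indicator (Function.uncurry G))) :
    ∫ τ in (0 : ℝ)..t, ∫ y in a₁..a₂, heaviside (c * (t - τ) - |x - y|) * G y τ
      = potential c ((Icc a₁ a₂ ×ˢ Icc 0 t).indicator (Function.uncurry G))
          (x - c * t) (x + c * t) := by
  set Φ := (Icc a₁ a₂ ×ˢ Icc 0 t).indicator (Function.uncurry G) with hΦdef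
  rw [potential, ← integral_indicator (measurableSet_cone _ _ _)]
  have h := integral_prod_symm (μ := (volume : Measure ℝ)) (ν := (volume : Measure ℝ)) _
    (hΦ.indicator (measurableSet_cone c (x - c * t) (x + c * t)))
  refine Eq.trans ?_ h.symm
  rw [intervalIntegral.integral_of_le ht, ← integral_Icc_eq_integral_Ioc,
    ← integral_indicator measurableSet_Icc]
  congr 1
  ext τ
  by_cases hτ : τ ∈ Icc 0 t
  · rw [indicator_of_mem hτ, intervalIntegral.integral_of_le ha, ← integral_Icc_eq_integral_Ioc,
      ← integral_indicator measurableSet_Icc]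
    apply integral_congr_ae
    filter_upwards [heaviside_mul_ae_eq_cone_indicator c x t τ (fun y => G y τ)] with y hy
    by_cases hya : y ∈ Icc a₁ a₂
    · rw [indicator_of_mem hya, hy]
      have hmem : (y, τ) ∈ Icc a₁ a₂ ×ˢ Icc 0 t := ⟨hya, hτ⟩
      by_cases hm : (y, τ) ∈ cone c (x - c * t) (x + c * t)
      · rw [indicator_of_mem (by exact hm), indicator_of_mem hm, hΦdef, indicator_of_mem hmem]
        rfl
      · rw [indicator_of_notMem (by exact hm), indicator_of_notMem hm]
    · rw [indicator_of_notMem hya]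
      have hmem : (y, τ) ∉ Icc a₁ a₂ ×ˢ Icc 0 t := fun h => hya h.1
      exact (indicator_apply_eq_zero.2 fun _ => indicator_of_notMem hmem _).symm
  · rw [indicator_of_notMem hτ]
    have : ∀ y, (cone c (x - c * t) (x + c * t)).indicator Φ (y, τ) = 0 := by
      intro y
      have hmem : (y, τ) ∉ Icc a₁ a₂ ×ˢ Icc 0 t := fun h => hτ h.2
      exact indicator_apply_eq_zero.2 fun _ => indicator_of_notMem hmem _
    simp [this]

/-! ### Partial derivatives of a classical solution off the fronts. -/

theorem isClosed_fronts {c : ℝ} {A B : Set ℝ} (hA : IsClosed A) (hB : IsClosed B) :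
    IsClosed (fronts c A B) :=
  (hA.preimage (f := fun q : ℝ × ℝ => q.1 - c * q.2) (by fun_prop)).union
    (hB.preimage (f := fun q : ℝ × ℝ => q.1 + c * q.2) (by fun_prop))

theorem isOpen_openCylinder (a₁ a₂ : ℝ) : IsOpen (openCylinder a₁ a₂) :=
  isOpen_Ioo.prod isOpen_Ioi

theorem openCylinder_subset_cylinder (a₁ a₂ : ℝ) : openCylinder a₁ a₂ ⊆ cylinder a₁ a₂ :=
  prod_mono Ioo_subset_Icc_self Ioi_subset_Ici_self

theorem uniqueDiffOn_cylinder_diff {a₁ a₂ : ℝ} (ha : a₁ < a₂) {F : Set (ℝ × ℝ)} (hF : IsClosed F) :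
    UniqueDiffOn ℝ (cylinder a₁ a₂ \ F) := by
  rw [sdiff_eq]
  exact ((uniqueDiffOn_Icc ha).prod (uniqueDiffOn_Ici 0)).inter hF.isOpen_compl

theorem hasDerivAt_fderiv_apply {U : ℝ × ℝ → ℝ} {D : ℝ × ℝ →L[ℝ] ℝ × ℝ →L[ℝ] ℝ} {p : ℝ → ℝ × ℝ}
    {p' : ℝ × ℝ} {y : ℝ} (hU : HasFDerivAt (fderiv ℝ U) D (p y)) (hp : HasDerivAt p p' y)
    (v : ℝ × ℝ) : HasDerivAt (fun y => fderiv ℝ U (p y) v) (D p' v) y := by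
  have h1 : HasDerivAt (fun y => fderiv ℝ U (p y)) (D p') y := hU.comp_hasDerivAt y hp
  exact ((ContinuousLinearMap.apply ℝ ℝ v).hasFDerivAt.comp_hasDerivAt y h1)

theorem dx_reflect (a₁ a₂ : ℝ) (u : ℝ → ℝ → ℝ) (x t : ℝ) :
    dx (-a₂) (-a₁) (fun x t => u (-x) t) x t = - dx a₁ a₂ u (-x) t := by
  simp only [dx]
  have h := derivWithin_comp_neg (f := fun y => u y t) (s := Icc (-a₂) (-a₁)) (x := x)
  simpa using h

namespace IsClassicalSolution

variable {c a₁ a₂ : ℝ} {G : ℝ → ℝ → ℝ} {A B : Set ℝ} {u : ℝ → ℝ → ℝ}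

theorem isClosed_fronts (hu : IsClassicalSolution c a₁ a₂ G A B u) : IsClosed (fronts c A B) :=
  Wave1D.isClosed_fronts hu.closed_right hu.closed_left

theorem hasFDerivWithinAt (hu : IsClassicalSolution c a₁ a₂ G A B u) {q : ℝ × ℝ}
    (hq : q ∈ cylinder a₁ a₂ \ fronts c A B) :
    HasFDerivWithinAt (Function.uncurry u)
      (fderivWithin ℝ (Function.uncurry u) (cylinder a₁ a₂ \ fronts c A B) q)
      (cylinder a₁ a₂ \ fronts c A B) q :=
  (hu.contDiffOn_one.differentiableOn one_ne_zero q hq).hasFDerivWithinAt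

theorem continuousOn_fderivWithin (hu : IsClassicalSolution c a₁ a₂ G A B u) (ha : a₁ < a₂) :
    ContinuousOn (fderivWithin ℝ (Function.uncurry u) (cylinder a₁ a₂ \ fronts c A B))
      (cylinder a₁ a₂ \ fronts c A B) :=
  hu.contDiffOn_one.continuousOn_fderivWithin
    (uniqueDiffOn_cylinder_diff ha hu.isClosed_fronts) le_rfl

theorem hasDerivWithinAt_fst_aux (hu : IsClassicalSolution c a₁ a₂ G A B u) {x t : ℝ}
    (hq : (x, t) ∈ cylinder a₁ a₂ \ fronts c A B) :
    HasDerivWithinAt (fun y => u y t)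
      (fderivWithin ℝ (Function.uncurry u) (cylinder a₁ a₂ \ fronts c A B) (x, t) (1, 0))
      (Icc a₁ a₂) x := by
  have hopen : IsOpen {y : ℝ | (y, t) ∉ fronts c A B} :=
    hu.isClosed_fronts.isOpen_compl.preimage (by fun_prop : Continuous fun y : ℝ => (y, t))
  rw [← hasDerivWithinAt_inter (hopen.mem_nhds hq.2)]
  have h1 : HasDerivWithinAt (fun y : ℝ => (y, t)) (1, 0)
      (Icc a₁ a₂ ∩ {y : ℝ | (y, t) ∉ fronts c A B}) x :=
    ((hasDerivAt_id x).prodMk (hasDerivAt_const x t)).hasDerivWithinAt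
  have h2 : MapsTo (fun y : ℝ => (y, t)) (Icc a₁ a₂ ∩ {y : ℝ | (y, t) ∉ fronts c A B})
      (cylinder a₁ a₂ \ fronts c A B) := fun y hy => ⟨⟨hy.1, hq.1.2⟩, hy.2⟩
  exact (hu.hasFDerivWithinAt hq).comp_hasDerivWithinAt x h1 h2

theorem hasDerivWithinAt_snd_aux (hu : IsClassicalSolution c a₁ a₂ G A B u) {x t : ℝ}
    (hq : (x, t) ∈ cylinder a₁ a₂ \ fronts c A B) :
    HasDerivWithinAt (fun s => u x s)
      (fderivWithin ℝ (Function.uncurry u) (cylinder a₁ a₂ \ fronts c A B) (x, t) (0, 1))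
      (Ici 0) t := by
  have hopen : IsOpen {s : ℝ | (x, s) ∉ fronts c A B} :=
    hu.isClosed_fronts.isOpen_compl.preimage (by fun_prop : Continuous fun s : ℝ => (x, s))
  rw [← hasDerivWithinAt_inter (hopen.mem_nhds hq.2)]
  have h1 : HasDerivWithinAt (fun s : ℝ => (x, s)) (0, 1)
      (Ici 0 ∩ {s : ℝ | (x, s) ∉ fronts c A B}) t :=
    ((hasDerivAt_const t x).prodMk (hasDerivAt_id t)).hasDerivWithinAt
  have h2 : MapsTo (fun s : ℝ => (x, s)) (Ici 0 ∩ {s : ℝ | (x, s) ∉ fronts c A B})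
      (cylinder a₁ a₂ \ fronts c A B) := fun s hs => ⟨⟨hq.1.1, hs.1⟩, hs.2⟩
  exact (hu.hasFDerivWithinAt hq).comp_hasDerivWithinAt t h1 h2

theorem dx_eq (hu : IsClassicalSolution c a₁ a₂ G A B u) (ha : a₁ < a₂) {q : ℝ × ℝ}
    (hq : q ∈ cylinder a₁ a₂ \ fronts c A B) :
    dx a₁ a₂ u q.1 q.2 =
      fderivWithin ℝ (Function.uncurry u) (cylinder a₁ a₂ \ fronts c A B) q (1, 0) :=
  (hu.hasDerivWithinAt_fst_aux hq).derivWithin (uniqueDiffOn_Icc ha _ hq.1.1)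

theorem dt_eq (hu : IsClassicalSolution c a₁ a₂ G A B u) {q : ℝ × ℝ}
    (hq : q ∈ cylinder a₁ a₂ \ fronts c A B) :
    dt u q.1 q.2 =
      fderivWithin ℝ (Function.uncurry u) (cylinder a₁ a₂ \ fronts c A B) q (0, 1) :=
  (hu.hasDerivWithinAt_snd_aux hq).derivWithin (uniqueDiffOn_Ici 0 _ hq.1.2)

theorem hasDerivWithinAt_fst (hu : IsClassicalSolution c a₁ a₂ G A B u) (ha : a₁ < a₂) {x t : ℝ}
    (hq : (x, t) ∈ cylinder a₁ a₂ \ fronts c A B) :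
    HasDerivWithinAt (fun y => u y t) (dx a₁ a₂ u x t) (Icc a₁ a₂) x := by
  rw [hu.dx_eq ha hq]; exact hu.hasDerivWithinAt_fst_aux hq

theorem hasDerivWithinAt_snd (hu : IsClassicalSolution c a₁ a₂ G A B u) {x t : ℝ}
    (hq : (x, t) ∈ cylinder a₁ a₂ \ fronts c A B) :
    HasDerivWithinAt (fun s => u x s) (dt u x t) (Ici 0) t := by
  rw [hu.dt_eq hq]; exact hu.hasDerivWithinAt_snd_aux hq

theorem continuousOn_dx (hu : IsClassicalSolution c a₁ a₂ G A B u) (ha : a₁ < a₂) :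
    ContinuousOn (fun q : ℝ × ℝ => dx a₁ a₂ u q.1 q.2) (cylinder a₁ a₂ \ fronts c A B) :=
  ((hu.continuousOn_fderivWithin ha).clm_apply continuousOn_const).congr
    fun _ hq => hu.dx_eq ha hq

theorem continuousOn_dt (hu : IsClassicalSolution c a₁ a₂ G A B u) (ha : a₁ < a₂) :
    ContinuousOn (fun q : ℝ × ℝ => dt u q.1 q.2) (cylinder a₁ a₂ \ fronts c A B) :=
  ((hu.continuousOn_fderivWithin ha).clm_apply continuousOn_const).congr
    fun _ hq => hu.dt_eq hq

theorem mem_nhds_of_mem_open (hu : IsClassicalSolution c a₁ a₂ G A B u) {q : ℝ × ℝ}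
    (hq : q ∈ openCylinder a₁ a₂ \ fronts c A B) : openCylinder a₁ a₂ \ fronts c A B ∈ 𝓝 q :=
  ((isOpen_openCylinder a₁ a₂).sdiff hu.isClosed_fronts).mem_nhds hq

theorem hasFDerivAt (hu : IsClassicalSolution c a₁ a₂ G A B u) {q : ℝ × ℝ}
    (hq : q ∈ openCylinder a₁ a₂ \ fronts c A B) :
    HasFDerivAt (Function.uncurry u) (fderiv ℝ (Function.uncurry u) q) q :=
  ((hu.contDiffOn_two.contDiffAt (hu.mem_nhds_of_mem_open hq)).differentiableAt
    two_ne_zero).hasFDerivAt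

theorem fderivWithin_eq_fderiv (hu : IsClassicalSolution c a₁ a₂ G A B u) {q : ℝ × ℝ}
    (hq : q ∈ openCylinder a₁ a₂ \ fronts c A B) :
    fderivWithin ℝ (Function.uncurry u) (cylinder a₁ a₂ \ fronts c A B) q
      = fderiv ℝ (Function.uncurry u) q :=
  fderivWithin_of_mem_nhds (mem_of_superset (hu.mem_nhds_of_mem_open hq)
    (sdiff_subset_sdiff_left (openCylinder_subset_cylinder _ _)))

theorem dx_eq_fderiv (hu : IsClassicalSolution c a₁ a₂ G A B u) (ha : a₁ < a₂) {q : ℝ × ℝ}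
    (hq : q ∈ openCylinder a₁ a₂ \ fronts c A B) :
    dx a₁ a₂ u q.1 q.2 = fderiv ℝ (Function.uncurry u) q (1, 0) := by
  rw [hu.dx_eq ha ⟨openCylinder_subset_cylinder _ _ hq.1, hq.2⟩, hu.fderivWithin_eq_fderiv hq]

theorem dt_eq_fderiv (hu : IsClassicalSolution c a₁ a₂ G A B u) {q : ℝ × ℝ}
    (hq : q ∈ openCylinder a₁ a₂ \ fronts c A B) :
    dt u q.1 q.2 = fderiv ℝ (Function.uncurry u) q (0, 1) := by
  rw [hu.dt_eq ⟨openCylinder_subset_cylinder _ _ hq.1, hq.2⟩, hu.fderivWithin_eq_fderiv hq]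

theorem hasFDerivAt_fderiv (hu : IsClassicalSolution c a₁ a₂ G A B u) {q : ℝ × ℝ}
    (hq : q ∈ openCylinder a₁ a₂ \ fronts c A B) :
    HasFDerivAt (fderiv ℝ (Function.uncurry u))
      (fderiv ℝ (fderiv ℝ (Function.uncurry u)) q) q := by
  have h := hu.contDiffOn_two.contDiffAt (hu.mem_nhds_of_mem_open hq)
  exact ((h.fderiv_right (m := 1) (by norm_num)).differentiableAt one_ne_zero).hasFDerivAt

theorem iteratedDeriv_fst (hu : IsClassicalSolution c a₁ a₂ G A B u) {x t : ℝ}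
    (hq : (x, t) ∈ openCylinder a₁ a₂ \ fronts c A B) :
    iteratedDeriv 2 (fun y => u y t) x
      = fderiv ℝ (fderiv ℝ (Function.uncurry u)) (x, t) (1, 0) (1, 0) := by
  rw [iteratedDeriv_succ, iteratedDeriv_one]
  have hline : ∀ y, HasDerivAt (fun y : ℝ => (y, t)) (1, 0) y := fun y =>
    (hasDerivAt_id y).prodMk (hasDerivAt_const y t)
  have hev : deriv (fun y => u y t) =ᶠ[𝓝 x]
      fun y => fderiv ℝ (Function.uncurry u) (y, t) (1, 0) := by
    filter_upwards [(hline x).continuousAt.eventually (hu.mem_nhds_of_mem_open hq)] with y hy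
    exact ((hu.hasFDerivAt hy).comp_hasDerivAt y (hline y)).deriv
  rw [hev.deriv_eq]
  exact (hasDerivAt_fderiv_apply (p := fun y => (y, t)) (hu.hasFDerivAt_fderiv hq) (hline x)
    (1, 0)).deriv

theorem iteratedDeriv_snd (hu : IsClassicalSolution c a₁ a₂ G A B u) {x t : ℝ}
    (hq : (x, t) ∈ openCylinder a₁ a₂ \ fronts c A B) :
    iteratedDeriv 2 (fun s => u x s) t
      = fderiv ℝ (fderiv ℝ (Function.uncurry u)) (x, t) (0, 1) (0, 1) := by
  rw [iteratedDeriv_succ, iteratedDeriv_one]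
  have hline : ∀ s, HasDerivAt (fun s : ℝ => (x, s)) (0, 1) s := fun s =>
    (hasDerivAt_const s x).prodMk (hasDerivAt_id s)
  have hev : deriv (fun s => u x s) =ᶠ[𝓝 t]
      fun s => fderiv ℝ (Function.uncurry u) (x, s) (0, 1) := by
    filter_upwards [(hline t).continuousAt.eventually (hu.mem_nhds_of_mem_open hq)] with s hs
    exact ((hu.hasFDerivAt hs).comp_hasDerivAt s (hline s)).deriv
  rw [hev.deriv_eq]
  exact (hasDerivAt_fderiv_apply (p := fun s => (x, s)) (hu.hasFDerivAt_fderiv hq) (hline t)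
    (0, 1)).deriv

/-- Along the characteristic `y - c τ = s` the derivative of `u_t - c u_x` is `-c G`. -/
theorem hasDerivAt_line (hu : IsClassicalSolution c a₁ a₂ G A B u) (hc : 0 < c) (ha : a₁ < a₂)
    {s y : ℝ} (hq : (y, (y - s) / c) ∈ openCylinder a₁ a₂ \ fronts c A B) :
    HasDerivAt (fun y => dt u y ((y - s) / c) - c * dx a₁ a₂ u y ((y - s) / c))
      (-(c * G y ((y - s) / c))) y := by
  have hline : HasDerivAt (fun y : ℝ => (y, (y - s) / c)) ((1, 1 / c) : ℝ × ℝ) y :=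
    (hasDerivAt_id y).prodMk (((hasDerivAt_id y).sub_const s).div_const c)
  have hev : (fun y => dt u y ((y - s) / c) - c * dx a₁ a₂ u y ((y - s) / c)) =ᶠ[𝓝 y]
      fun y => fderiv ℝ (Function.uncurry u) (y, (y - s) / c) ((0, 1) - c • (1, 0)) := by
    filter_upwards [hline.continuousAt.eventually (hu.mem_nhds_of_mem_open hq)] with z hz
    rw [hu.dt_eq_fderiv hz, hu.dx_eq_fderiv ha hz, map_sub, map_smul, smul_eq_mul]
  have h := hasDerivAt_fderiv_apply (p := fun y => (y, (y - s) / c)) (hu.hasFDerivAt_fderiv hq)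
    hline ((0, 1) - c • (1, 0))
  refine (h.congr_of_eventuallyEq hev).congr_deriv ?_
  have heq := hu.equation _ _ hq
  rw [hu.iteratedDeriv_fst hq, hu.iteratedDeriv_snd hq] at heq
  -- The mixed derivatives cancel in `(∂ₓ + c⁻¹ ∂ₜ)(∂ₜ - c ∂ₓ) = -c (∂ₓ² - c⁻² ∂ₜ²)`.
  have hsymm : IsSymmSndFDerivAt ℝ (Function.uncurry u) (y, (y - s) / c) :=
    (hu.contDiffOn_two.contDiffAt (hu.mem_nhds_of_mem_open hq)).isSymmSndFDerivAt (by simp)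
  have hs := hsymm (1, 0) (0, 1)
  have e : ((1, 1 / c) : ℝ × ℝ) = (1, 0) + (1 / c) • (0, 1) := by simp
  rw [e, ← heq]
  simp only [map_add, map_sub, map_smul, _root_.add_apply,
    _root_.smul_apply, smul_eq_mul, hs]
  field_simp
  ring

/-! ### Invariance under `x ↦ -x`. -/

/-- The reflection keeps `u_t`, changes the sign of `u_x` and exchanges the two families of fronts,
hence also the two Hadamard conditions. It lets every statement about the left wall serve for the
right one. -/
theorem reflect (hu : IsClassicalSolution c a₁ a₂ G A B u) :
    IsClassicalSolution c (-a₂) (-a₁) (fun x t => G (-x) t) {b | -b ∈ B} {b | -b ∈ A}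
      (fun x t => u (-x) t) := by
  have hr : ContDiff ℝ 2 (fun q : ℝ × ℝ => (-q.1, q.2)) := by fun_prop
  have hcyl : ∀ q : ℝ × ℝ, q ∈ cylinder (-a₂) (-a₁) → (-q.1, q.2) ∈ cylinder a₁ a₂ :=
    fun q hq => ⟨⟨by linarith [hq.1.2], by linarith [hq.1.1]⟩, hq.2⟩
  have hopen : ∀ q : ℝ × ℝ, q ∈ openCylinder (-a₂) (-a₁) → (-q.1, q.2) ∈ openCylinder a₁ a₂ :=
    fun q hq => ⟨⟨by linarith [hq.1.2], by linarith [hq.1.1]⟩, hq.2⟩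
  have hfr : ∀ q : ℝ × ℝ, q ∉ fronts c {b | -b ∈ B} {b | -b ∈ A} →
      (-q.1, q.2) ∉ fronts c A B := by
    rintro q hq (h | h)
    · exact hq (Or.inr (show -(q.1 + c * q.2) ∈ A by convert h using 1; ring))
    · exact hq (Or.inl (show -(q.1 - c * q.2) ∈ B by convert h using 1; ring))
  have hlim : ∀ x t : ℝ, Tendsto (fun q : ℝ × ℝ => (-q.1, q.2))
      (𝓝[cylinder (-a₂) (-a₁) \ fronts c {b | -b ∈ B} {b | -b ∈ A}] (x, t))
      (𝓝[cylinder a₁ a₂ \ fronts c A B] (-x, t)) := by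
    intro x t
    refine tendsto_nhdsWithin_iff.2 ⟨?_, ?_⟩
    · exact (hr.continuous.tendsto (x, t)).mono_left nhdsWithin_le_nhds
    · filter_upwards [self_mem_nhdsWithin] with q hq
      exact ⟨hcyl q hq.1, hfr q hq.2⟩
  refine ⟨hu.closed_left.preimage continuous_neg, ?_, hu.closed_right.preimage continuous_neg, ?_,
    ?_, ?_, ?_, ?_, ?_, ?_⟩
  · exact hu.countable_left.preimage neg_injective
  · exact hu.countable_right.preimage neg_injective
  · exact hu.continuousOn.comp hr.continuous.continuousOn hcyl
  · exact hu.contDiffOn_one.comp (hr.of_le one_le_two).contDiffOn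
      fun q hq => ⟨hcyl q hq.1, hfr q hq.2⟩
  · exact hu.contDiffOn_two.comp hr.contDiffOn fun q hq => ⟨hopen q hq.1, hfr q hq.2⟩
  · intro x t hq
    have h := hu.equation (-x) t ⟨hopen _ hq.1, hfr _ hq.2⟩
    rw [← h]
    have := iteratedDeriv_comp_neg 2 (fun y => u y t) x
    rw [this]; simp
  · intro x t hq h1 h2
    obtain ⟨L, hL⟩ := hu.hadamard_left (-x) t (hopen _ hq)
      (by have : -(x - c * t) ∈ B := h1
          convert this using 1; ring)
      (fun h => h2 (show -(x + c * t) ∈ A by convert h using 1; ring))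
    refine ⟨L, ?_⟩
    refine (hL.comp (hlim x t)).congr fun q => ?_
    simp only [Function.comp, dx_reflect, dt]; ring
  · intro x t hq h1 h2
    obtain ⟨L, hL⟩ := hu.hadamard_right (-x) t (hopen _ hq)
      (by have : -(x + c * t) ∈ A := h1
          convert this using 1; ring)
      (fun h => h2 (show -(x - c * t) ∈ B by convert h using 1; ring))
    refine ⟨L, ?_⟩
    refine (hL.comp (hlim x t)).congr fun q => ?_
    simp only [Function.comp, dx_reflect, dt]; ring

end IsClassicalSolution

theorem HasInitialData.reflect {c a₁ a₂ : ℝ} {A B : Set ℝ} {u : ℝ → ℝ → ℝ} {u₀ v₀ : ℝ → ℝ}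
    (h : HasInitialData c a₁ a₂ A B u u₀ v₀) :
    HasInitialData c (-a₂) (-a₁) {b | -b ∈ B} {b | -b ∈ A} (fun x t => u (-x) t)
      (fun x => u₀ (-x)) (fun x => v₀ (-x)) := by
  refine ⟨fun x hx => h.value _ ⟨by linarith [hx.2], by linarith [hx.1]⟩, fun x hx hq => ?_⟩
  refine h.velocity _ ⟨by linarith [hx.2], by linarith [hx.1]⟩ ?_
  rintro (hm | hm)
  · exact hq (Or.inr (show -(x + c * 0) ∈ A by convert hm using 1; ring))
  · exact hq (Or.inl (show -(x - c * 0) ∈ B by convert hm using 1; ring))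

/-- The source term restricted to times in `[0, T]` and extended by zero. -/
noncomputable def source (a₁ a₂ : ℝ) (G : ℝ → ℝ → ℝ) (T : ℝ) : ℝ × ℝ → ℝ :=
  (Icc a₁ a₂ ×ˢ Icc 0 T).indicator (Function.uncurry G)

/-- All the hypotheses on the initial-boundary value problem; invariant under `x ↦ -x`. -/
structure IsAdmissible (c a₁ a₂ : ℝ) (G : ℝ → ℝ → ℝ) (A B : Set ℝ) (u : ℝ → ℝ → ℝ)
    (u₀ v₀ : ℝ → ℝ) : Prop where
  c_pos : 0 < c
  lt : a₁ < a₂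
  integrable_source : ∀ T, Integrable (source a₁ a₂ G T)
  sol : IsClassicalSolution c a₁ a₂ G A B u
  init : HasInitialData c a₁ a₂ A B u u₀ v₀
  integrable_velocity : IntervalIntegrable v₀ volume a₁ a₂
  integrable_left : ∀ T : ℝ, 0 < T → IntervalIntegrable (fun τ => dx a₁ a₂ u a₁ τ) volume 0 T
  integrable_right : ∀ T : ℝ, 0 < T → IntervalIntegrable (fun τ => dx a₁ a₂ u a₂ τ) volume 0 T

theorem measurePreserving_neg_fst :
    MeasurePreserving (fun q : ℝ × ℝ => (-q.1, q.2)) volume volume :=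
  (Measure.measurePreserving_neg (volume : Measure ℝ)).prod (MeasurePreserving.id volume)

theorem measurableEmbedding_neg_fst : MeasurableEmbedding (fun q : ℝ × ℝ => (-q.1, q.2)) :=
  ((Homeomorph.neg ℝ).prodCongr (Homeomorph.refl ℝ)).measurableEmbedding

theorem source_reflect (a₁ a₂ : ℝ) (G : ℝ → ℝ → ℝ) (T : ℝ) :
    source (-a₂) (-a₁) (fun x t => G (-x) t) T = fun q => source a₁ a₂ G T (-q.1, q.2) := by
  ext q
  have h : q ∈ Icc (-a₂) (-a₁) ×ˢ Icc 0 T ↔ (-q.1, q.2) ∈ Icc a₁ a₂ ×ˢ Icc 0 T := by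
    simp only [mem_prod, mem_Icc]
    constructor <;> rintro ⟨⟨h1, h2⟩, h3⟩ <;> exact ⟨⟨by linarith, by linarith⟩, h3⟩
  by_cases hq : q ∈ Icc (-a₂) (-a₁) ×ˢ Icc 0 T
  · rw [source, source, indicator_of_mem hq, indicator_of_mem (h.1 hq)]; rfl
  · rw [source, source, indicator_of_notMem hq, indicator_of_notMem fun h' => hq (h.2 h')]

theorem potential_reflect (c : ℝ) (Φ : ℝ × ℝ → ℝ) (ξ η : ℝ) :
    potential c (fun q => Φ (-q.1, q.2)) (-η) (-ξ) = potential c Φ ξ η := by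
  have h := measurePreserving_neg_fst.setIntegral_preimage_emb measurableEmbedding_neg_fst Φ
    (cone c ξ η)
  rw [potential, potential, ← h]
  congr 2
  ext q
  simp only [cone, mem_preimage, mem_ofPred_eq]
  constructor <;> rintro ⟨h1, h2⟩ <;> constructor <;> linarith

theorem IsAdmissible.reflect {c a₁ a₂ : ℝ} {G : ℝ → ℝ → ℝ} {A B : Set ℝ} {u : ℝ → ℝ → ℝ}
    {u₀ v₀ : ℝ → ℝ} (h : IsAdmissible c a₁ a₂ G A B u u₀ v₀) :
    IsAdmissible c (-a₂) (-a₁) (fun x t => G (-x) t) {b | -b ∈ B} {b | -b ∈ A}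
      (fun x t => u (-x) t) (fun x => u₀ (-x)) (fun x => v₀ (-x)) where
  c_pos := h.c_pos
  lt := neg_lt_neg h.lt
  integrable_source T := by
    rw [source_reflect]
    exact measurePreserving_neg_fst.integrable_comp_of_integrable (h.integrable_source T)
  sol := h.sol.reflect
  init := h.init.reflect
  integrable_velocity := by
    have := (IntervalIntegrable.iff_comp_neg (f := v₀) (a := a₁) (b := a₂)).1
      h.integrable_velocity
    exact this.symm
  integrable_left T hT := by
    simp only [dx_reflect, neg_neg]
    exact (h.integrable_right T hT).neg
  integrable_right T hT := by
    simp only [dx_reflect, neg_neg]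
    exact (h.integrable_left T hT).neg

/-! ### The flux `u_t - c u_x` and its values at the data boundary. -/

/-- Twice the right-moving part of the solution that is determined by the initial data and by the
boundary slope `p` and the boundary value `q` at the left endpoint `a`. -/
noncomputable def leftData (c a : ℝ) (p q u₀ v₀ : ℝ → ℝ) (ξ : ℝ) : ℝ :=
  if a < ξ then u₀ ξ - c⁻¹ * ∫ y in a..ξ, v₀ y
  else q ((a - ξ) / c) - c * ∫ τ in (0 : ℝ)..((a - ξ) / c), p τ

/-- `u_t - c u_x` along the characteristic `y - c τ = s`. -/
noncomputable def flux (c a₁ a₂ : ℝ) (u : ℝ → ℝ → ℝ) (s y : ℝ) : ℝ :=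
  dt u y ((y - s) / c) - c * dx a₁ a₂ u y ((y - s) / c)

namespace IsAdmissible

variable {c a₁ a₂ : ℝ} {G : ℝ → ℝ → ℝ} {A B : Set ℝ} {u : ℝ → ℝ → ℝ} {u₀ v₀ : ℝ → ℝ}

/-- The abscissa `max s a₁` is where the characteristic enters the cylinder: through the initial
line if `s ≥ a₁`, through the left wall otherwise. As `s ∉ A`, only left-moving fronts are crossed,
at countably many points, and the flux has a limit at each; so its continuous extension obeys the
fundamental theorem of calculus. -/
theorem flux_sub_flux (h : IsAdmissible c a₁ a₂ G A B u u₀ v₀) {T s e z : ℝ}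
    (he : e = max s a₁) (hez : e < z) (hz : z < a₂) (hT : (z - s) / c ≤ T) (hs : s ∉ A)
    (heB : 2 * e - s ∉ B) (hzB : 2 * z - s ∉ B)
    (hint : Integrable (fun y => source a₁ a₂ G T (y, (y - s) / c))) :
    flux c a₁ a₂ u s z - flux c a₁ a₂ u s e
      = -(c * slice c (source a₁ a₂ G T) (2 * z - s) s) := by
  have hc := h.c_pos
  have hes : s ≤ e := he ▸ le_max_left _ _
  have hea : a₁ ≤ e := he ▸ le_max_right _ _
  have hcm : ∀ y : ℝ, c * ((y - s) / c) = y - s := fun y => by field_simp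
  have hcyl : ∀ y ∈ Icc e z, (y, (y - s) / c) ∈ cylinder a₁ a₂ := fun y hy =>
    ⟨⟨hea.trans hy.1, hy.2.trans hz.le⟩, div_nonneg (by linarith [hy.1]) hc.le⟩
  have hopc : ∀ y ∈ Ioo e z, (y, (y - s) / c) ∈ openCylinder a₁ a₂ := fun y hy =>
    ⟨⟨hea.trans_lt hy.1, hy.2.trans hz⟩, div_pos (by linarith [hy.1]) hc⟩
  have hfr : ∀ y, 2 * y - s ∉ B → (y, (y - s) / c) ∉ fronts c A B := by
    rintro y hy (h1 | h1)
    · simp only [hcm] at h1; exact hs (by convert h1 using 1; ring)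
    · simp only [hcm] at h1; exact hy (by convert h1 using 1; ring)
  set good : Set ℝ := {y | 2 * y - s ∉ B} with hgood
  have hgood_open : IsOpen good :=
    h.sol.closed_left.isOpen_compl.preimage (by fun_prop : Continuous fun y : ℝ => 2 * y - s)
  have hbad : (goodᶜ).Countable := by
    have : (goodᶜ) = (fun y : ℝ => 2 * y - s) ⁻¹' B := by ext y; simp [hgood]
    rw [this]
    exact h.sol.countable_left.preimage fun x y hxy => by simpa using hxy
  have hdense : Dense good := by simpa using hbad.dense_compl ℝ
  have hcl : Icc e z ⊆ closure (Icc e z ∩ good) := by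
    rw [← closure_Ioo hez.ne]
    refine closure_minimal ?_ isClosed_closure
    refine (hdense.open_subset_closure_inter isOpen_Ioo).trans (closure_mono ?_)
    exact inter_subset_inter_left _ subset_closure
  have hline : Continuous fun y : ℝ => (y, (y - s) / c) := by fun_prop
  have hmaps : MapsTo (fun y : ℝ => (y, (y - s) / c)) (Icc e z ∩ good)
      (cylinder a₁ a₂ \ fronts c A B) := fun y hy => ⟨hcyl y hy.1, hfr y hy.2⟩
  have hcont : ContinuousOn (flux c a₁ a₂ u s) (Icc e z ∩ good) :=
    ((h.sol.continuousOn_dt h.lt).comp hline.continuousOn hmaps).sub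
      (continuousOn_const.mul ((h.sol.continuousOn_dx h.lt).comp hline.continuousOn hmaps))
  have hlim : ∀ y ∈ Icc e z, ∃ L, Tendsto (flux c a₁ a₂ u s) (𝓝[Icc e z ∩ good] y) (𝓝 L) := by
    intro y hy
    by_cases hyg : y ∈ good
    · exact ⟨_, hcont y ⟨hy, hyg⟩⟩
    · have hyo : y ∈ Ioo e z := by
        refine ⟨lt_of_le_of_ne hy.1 ?_, lt_of_le_of_ne hy.2 ?_⟩
        · rintro rfl; exact hyg heB
        · rintro rfl; exact hyg hzB
      obtain ⟨L, hL⟩ := h.sol.hadamard_left y ((y - s) / c) (hopc y hyo)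
        (by rw [hcm]; have : 2 * y - s ∈ B := not_not.1 hyg
            convert this using 1; ring)
        (by rw [hcm]; convert hs using 1; ring_nf)
      exact ⟨L, hL.comp (tendsto_nhdsWithin_iff.2
        ⟨(hline.tendsto y).mono_left nhdsWithin_le_nhds,
          eventually_mem_nhdsWithin.mono fun w hw => hmaps hw⟩)⟩
  -- On a front the partial derivatives of `u` need not exist, so `flux` may take a meaningless
  -- value there; it is replaced by its limit.
  have hEc := continuousOn_extendFrom hcl hlim
  have hEeq : ∀ y ∈ Icc e z ∩ good,
      extendFrom (Icc e z ∩ good) (flux c a₁ a₂ u s) y = flux c a₁ a₂ u s y := fun y hy =>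
    extendFrom_eq (hcl hy.1) (hcont y hy)
  have hFTC := integral_eq_of_hasDerivAt_off_countable_of_le
    (extendFrom (Icc e z ∩ good) (flux c a₁ a₂ u s))
    (fun y => -(c * source a₁ a₂ G T (y, (y - s) / c))) hez.le hbad hEc
    (by
      rintro y ⟨hy, hyg⟩
      have hyg : y ∈ good := not_not.1 hyg
      have hd := h.sol.hasDerivAt_line hc h.lt ⟨hopc y hy, hfr y hyg⟩
      have hm : (y, (y - s) / c) ∈ Icc a₁ a₂ ×ˢ Icc 0 T := by
        refine ⟨(hcyl y (Ioo_subset_Icc_self hy)).1, (hcyl y (Ioo_subset_Icc_self hy)).2, ?_⟩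
        refine le_trans ?_ hT
        exact div_le_div_of_nonneg_right (by linarith [hy.2]) hc.le
      have hG : source a₁ a₂ G T (y, (y - s) / c) = G y ((y - s) / c) := indicator_of_mem hm _
      simp only [hG]
      refine hd.congr_of_eventuallyEq ?_
      filter_upwards [isOpen_Ioo.mem_nhds hy, hgood_open.mem_nhds hyg] with w hw hwg
      exact hEeq w ⟨Ioo_subset_Icc_self hw, hwg⟩)
    ((hint.const_mul c).neg.intervalIntegrable)
  rw [hEeq e ⟨left_mem_Icc.2 hez.le, heB⟩, hEeq z ⟨right_mem_Icc.2 hez.le, hzB⟩] at hFTC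
  rw [← hFTC, intervalIntegral.integral_neg, intervalIntegral.integral_const_mul, slice]
  -- `slice` integrates over the whole half-line `y < z`, but the source vanishes before the entry
  -- point `e`.
  congr 2
  rw [intervalIntegral.integral_of_le hez.le, ← integral_indicator measurableSet_Ioc]
  apply integral_congr_ae
  filter_upwards [Measure.ae_ne volume e, Measure.ae_ne volume z] with y hye hyz
  by_cases hy : y ∈ Ioc e z
  · rw [indicator_of_mem hy, indicator_of_mem]
    show 2 * y - s < 2 * z - s
    linarith [lt_of_le_of_ne hy.2 hyz]
  · rw [indicator_of_notMem hy]
    symm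
    refine indicator_apply_eq_zero.2 fun hy2 => indicator_of_notMem ?_ _
    have hyz' : y < z := by
      have : 2 * y - s < 2 * z - s := hy2
      linarith
    rintro ⟨h1, h2⟩
    have h3 : 0 ≤ y - s := by
      have := mul_nonneg hc.le h2.1
      simpa [hcm] using this
    refine hy ⟨lt_of_le_of_ne ?_ (Ne.symm hye), hyz'.le⟩
    rw [he]
    exact max_le (by linarith) h1.1

theorem intervalIntegrable_left (h : IsAdmissible c a₁ a₂ G A B u u₀ v₀) {T : ℝ} (hT : 0 ≤ T) :
    IntervalIntegrable (fun τ => dx a₁ a₂ u a₁ τ) volume 0 T := by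
  rcases hT.eq_or_lt with rfl | hT
  · simp
  · exact h.integrable_left T hT

theorem continuousOn_initial (h : IsAdmissible c a₁ a₂ G A B u u₀ v₀) :
    ContinuousOn u₀ (Icc a₁ a₂) := by
  have h1 : ContinuousOn (fun x => u x 0) (Icc a₁ a₂) :=
    h.sol.continuousOn.comp (f := fun x : ℝ => (x, (0 : ℝ))) (by fun_prop)
      fun x hx => ⟨hx, self_mem_Ici⟩
  exact h1.congr fun x hx => (h.init.value x hx).symm

theorem continuousOn_left (h : IsAdmissible c a₁ a₂ G A B u u₀ v₀) :
    ContinuousOn (fun t => u a₁ t) (Ici 0) :=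
  h.sol.continuousOn.comp (f := fun t : ℝ => (a₁, t)) (by fun_prop)
    fun _ ht => ⟨left_mem_Icc.2 h.lt.le, ht⟩

/-- The two branches fit together at the corner because `u a₁ 0 = u₀ a₁`. -/
theorem continuousOn_leftData (h : IsAdmissible c a₁ a₂ G A B u u₀ v₀) {T : ℝ} (hT : 0 ≤ T) :
    ContinuousOn (leftData c a₁ (dx a₁ a₂ u a₁) (u a₁) u₀ v₀) (Icc (a₁ - c * T) a₂) := by
  have hc := h.c_pos
  have hleft : ContinuousOn (leftData c a₁ (dx a₁ a₂ u a₁) (u a₁) u₀ v₀)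
      (Icc (a₁ - c * T) a₁) := by
    have hm : MapsTo (fun ξ : ℝ => (a₁ - ξ) / c) (Icc (a₁ - c * T) a₁) (Icc 0 T) := by
      intro ξ hξ
      refine ⟨div_nonneg (by linarith [hξ.2]) hc.le, ?_⟩
      rw [div_le_iff₀ hc]; linarith [hξ.1]
    have h1 : ContinuousOn (fun t => ∫ τ in (0 : ℝ)..t, dx a₁ a₂ u a₁ τ) (Icc 0 T) := by
      have := intervalIntegral.continuousOn_primitive_interval (μ := volume) (a := 0) (b := T)
        (f := fun τ => dx a₁ a₂ u a₁ τ) (by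
          rw [uIcc_of_le hT]
          exact (intervalIntegrable_iff_integrableOn_Icc_of_le hT).1 (h.intervalIntegrable_left hT))
      rwa [uIcc_of_le hT] at this
    have h2 : ContinuousOn (fun ξ : ℝ => (a₁ - ξ) / c) (Icc (a₁ - c * T) a₁) := by fun_prop
    have h3 := ((h.continuousOn_left.mono Icc_subset_Ici_self).comp h2 hm).sub
      (continuousOn_const (c := c) |>.mul (h1.comp h2 hm))
    exact h3.congr fun ξ hξ => by simp [leftData, hξ.2.not_gt]
  have hright : ContinuousOn (leftData c a₁ (dx a₁ a₂ u a₁) (u a₁) u₀ v₀) (Icc a₁ a₂) := by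
    have h1 : ContinuousOn (fun ξ => ∫ y in a₁..ξ, v₀ y) (Icc a₁ a₂) := by
      have := intervalIntegral.continuousOn_primitive_interval (μ := volume) (a := a₁) (b := a₂)
        (f := v₀) (by
          rw [uIcc_of_le h.lt.le]
          exact (intervalIntegrable_iff_integrableOn_Icc_of_le h.lt.le).1 h.integrable_velocity)
      rwa [uIcc_of_le h.lt.le] at this
    refine (h.continuousOn_initial.sub (continuousOn_const (c := c⁻¹) |>.mul h1)).congr
      fun ξ hξ => ?_
    rcases hξ.1.eq_or_lt with rfl | hlt
    · simp [leftData, h.init.value _ hξ]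
    · simp [leftData, hlt]
  refine (hleft.union_of_isClosed hright isClosed_Icc isClosed_Icc).mono fun ξ hξ => ?_
  rcases le_total ξ a₁ with h1 | h1
  · exact Or.inl ⟨hξ.1, h1⟩
  · exact Or.inr ⟨h1, hξ.2⟩

theorem stronglyMeasurableAtFilter_of_intervalIntegrable {f : ℝ → ℝ} {a b x : ℝ}
    (hf : IntervalIntegrable f volume a b) (hx : x ∈ Ioo a b) :
    StronglyMeasurableAtFilter f (𝓝 x) :=
  ⟨Ioc a b, Ioc_mem_nhds hx.1 hx.2, hf.1.aestronglyMeasurable⟩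

theorem hasDerivAt_leftData_of_gt (h : IsAdmissible c a₁ a₂ G A B u u₀ v₀) {s : ℝ}
    (hs : s ∈ Ioo a₁ a₂) (hsA : s ∉ A) (hsB : s ∉ B) :
    HasDerivAt (leftData c a₁ (dx a₁ a₂ u a₁) (u a₁) u₀ v₀)
      (-(c⁻¹ * flux c a₁ a₂ u s s)) s := by
  have hc := h.c_pos
  have hfr : (s, (0 : ℝ)) ∉ fronts c A B := by
    rintro (h1 | h1) <;> simp_all
  have hq : (s, (0 : ℝ)) ∈ cylinder a₁ a₂ \ fronts c A B :=
    ⟨⟨Ioo_subset_Icc_self hs, self_mem_Ici⟩, hfr⟩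
  have hnhds : Icc a₁ a₂ ∈ 𝓝 s := Icc_mem_nhds hs.1 hs.2
  have hu₀ : HasDerivAt u₀ (dx a₁ a₂ u s 0) s := by
    refine ((h.sol.hasDerivWithinAt_fst h.lt hq).hasDerivAt hnhds).congr_of_eventuallyEq ?_
    filter_upwards [hnhds] with y hy using (h.init.value y hy).symm
  have hopen : IsOpen {y : ℝ | (y, (0 : ℝ)) ∉ fronts c A B} :=
    h.sol.isClosed_fronts.isOpen_compl.preimage (by fun_prop : Continuous fun y : ℝ => (y, (0 : ℝ)))
  have hv : v₀ =ᶠ[𝓝 s] fun y => dt u y 0 := by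
    filter_upwards [isOpen_Ioo.mem_nhds hs, hopen.mem_nhds hfr] with y hy hyf
    exact (h.init.velocity y hy hyf).symm
  have hdt : ContinuousAt (fun y => dt u y 0) s := by
    have h1 : ContinuousOn (fun y => dt u y 0) (Ioo a₁ a₂ ∩ {y : ℝ | (y, (0 : ℝ)) ∉ fronts c A B}) :=
      (h.sol.continuousOn_dt h.lt).comp (f := fun y : ℝ => (y, (0 : ℝ))) (by fun_prop)
        fun y hy => ⟨⟨Ioo_subset_Icc_self hy.1, self_mem_Ici⟩, hy.2⟩
    exact h1.continuousAt ((isOpen_Ioo.inter hopen).mem_nhds ⟨hs, hfr⟩)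
  have hint : HasDerivAt (fun ξ => ∫ y in a₁..ξ, v₀ y) (v₀ s) s :=
    intervalIntegral.integral_hasDerivAt_right
      (h.integrable_velocity.mono_set (by
        rw [uIcc_of_le hs.1.le, uIcc_of_le h.lt.le]; exact Icc_subset_Icc_right hs.2.le))
      (stronglyMeasurableAtFilter_of_intervalIntegrable h.integrable_velocity hs)
      (hdt.congr hv.symm)
  refine ((hu₀.sub (hint.const_mul c⁻¹)).congr_of_eventuallyEq ?_).congr_deriv ?_
  · filter_upwards [lt_mem_nhds hs.1] with y hy
    simp [leftData, hy]
  · rw [hv.eq_of_nhds, flux, sub_self, zero_div]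
    field_simp
    ring

theorem hasDerivAt_leftData_of_lt (h : IsAdmissible c a₁ a₂ G A B u u₀ v₀) {s : ℝ}
    (hs : s < a₁) (hsA : s ∉ A) (hsB : 2 * a₁ - s ∉ B) :
    HasDerivAt (leftData c a₁ (dx a₁ a₂ u a₁) (u a₁) u₀ v₀)
      (-(c⁻¹ * flux c a₁ a₂ u s a₁)) s := by
  have hc := h.c_pos
  set τ := (a₁ - s) / c with hτ
  have hτ0 : 0 < τ := div_pos (by linarith) hc
  have hcτ : c * τ = a₁ - s := by rw [hτ]; field_simp
  have hfr : (a₁, τ) ∉ fronts c A B := by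
    rintro (h1 | h1)
    · exact hsA (by simpa [hcτ] using h1)
    · simp only [hcτ] at h1
      exact hsB (by convert h1 using 1; ring)
  have hopen : IsOpen {t : ℝ | (a₁, t) ∉ fronts c A B} :=
    h.sol.isClosed_fronts.isOpen_compl.preimage (by fun_prop : Continuous fun t : ℝ => (a₁, t))
  have ha₁ : a₁ ∈ Icc a₁ a₂ := left_mem_Icc.2 h.lt.le
  have hval : HasDerivAt (u a₁) (dt u a₁ τ) τ :=
    (h.sol.hasDerivWithinAt_snd ⟨⟨ha₁, hτ0.le⟩, hfr⟩).hasDerivAt (Ici_mem_nhds hτ0)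
  have hdx : ContinuousAt (fun t => dx a₁ a₂ u a₁ t) τ := by
    have h1 : ContinuousOn (fun t => dx a₁ a₂ u a₁ t) (Ioi 0 ∩ {t : ℝ | (a₁, t) ∉ fronts c A B}) :=
      (h.sol.continuousOn_dx h.lt).comp (f := fun t : ℝ => (a₁, t)) (by fun_prop)
        fun t ht => ⟨⟨ha₁, mem_Ici.2 (le_of_lt (mem_Ioi.1 ht.1))⟩, ht.2⟩
    exact h1.continuousAt ((isOpen_Ioi.inter hopen).mem_nhds ⟨hτ0, hfr⟩)
  have hint : HasDerivAt (fun t => ∫ τ in (0 : ℝ)..t, dx a₁ a₂ u a₁ τ) (dx a₁ a₂ u a₁ τ) τ :=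
    intervalIntegral.integral_hasDerivAt_right (h.intervalIntegrable_left hτ0.le)
      (stronglyMeasurableAtFilter_of_intervalIntegrable
        (h.intervalIntegrable_left (T := τ + 1) (by linarith)) ⟨hτ0, by linarith⟩) hdx
  have hin : HasDerivAt (fun s => (a₁ - s) / c) (-1 / c) s :=
    ((hasDerivAt_id s).const_sub a₁).div_const c
  have h3 := HasDerivAt.comp s (hval.sub (hint.const_mul c)) hin
  refine (h3.congr_of_eventuallyEq ?_).congr_deriv ?_
  · filter_upwards [gt_mem_nhds hs] with y hy
    simp [leftData, hy.not_gt]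
  · rw [flux, ← hτ]
    field_simp

/-- This is what `leftData` is designed for: on either branch its derivative is read off from the
flux at the entry point, which the last two hypotheses keep off the fronts. -/
theorem hasDerivAt_leftData (h : IsAdmissible c a₁ a₂ G A B u u₀ v₀) {s : ℝ}
    (hs : s < a₂) (hsa : s ≠ a₁) (hsA : s ∉ A) (hsB : 2 * max s a₁ - s ∉ B) :
    HasDerivAt (leftData c a₁ (dx a₁ a₂ u a₁) (u a₁) u₀ v₀)
      (-(c⁻¹ * flux c a₁ a₂ u s (max s a₁))) s := by
  rcases lt_or_gt_of_ne hsa with h1 | h1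
  · rw [max_eq_right h1.le] at hsB ⊢
    exact h.hasDerivAt_leftData_of_lt h1 hsA hsB
  · rw [max_eq_left h1.le] at hsB ⊢
    exact h.hasDerivAt_leftData_of_gt ⟨h1, hs⟩ hsA (by convert hsB using 1; ring_nf)

end IsAdmissible

/-! ### Constancy of the defect along left-moving characteristics. -/

/-- Twice the solution, minus the source contribution and the right-moving part determined by the
data; it is constant along the characteristics `x + c t = η`. -/
noncomputable def leftDefect (c a₁ a₂ : ℝ) (G : ℝ → ℝ → ℝ) (u : ℝ → ℝ → ℝ) (u₀ v₀ : ℝ → ℝ)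
    (T : ℝ) (q : ℝ × ℝ) : ℝ :=
  2 * u q.1 q.2 - leftData c a₁ (dx a₁ a₂ u a₁) (u a₁) u₀ v₀ (q.1 - c * q.2)
    + c * potential c (source a₁ a₂ G T) (q.1 - c * q.2) (q.1 + c * q.2)

namespace IsAdmissible

variable {c a₁ a₂ : ℝ} {G : ℝ → ℝ → ℝ} {A B : Set ℝ} {u : ℝ → ℝ → ℝ} {u₀ v₀ : ℝ → ℝ}

/-- The point with `x - c t = s` and `x + c t = η` moves with velocity `(1/2, -1/(2c))` in `s`, and
`(1/2)(u_x - u_t/c)` is the flux up to a factor. -/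
theorem hasDerivAt_along_left (h : IsAdmissible c a₁ a₂ G A B u u₀ v₀) {s η : ℝ}
    (hq : ((s + η) / 2, ((s + η) / 2 - s) / c) ∈ openCylinder a₁ a₂ \ fronts c A B) :
    HasDerivAt (fun s => u ((s + η) / 2) (((s + η) / 2 - s) / c))
      (-(flux c a₁ a₂ u s ((s + η) / 2) / (2 * c))) s := by
  have hc := h.c_pos
  have h1 : HasDerivAt (fun s : ℝ => (s + η) / 2) (1 / 2) s :=
    ((hasDerivAt_id s).add_const η).div_const 2
  have hp : HasDerivAt (fun s : ℝ => ((s + η) / 2, ((s + η) / 2 - s) / c))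
      ((1 / 2, (1 / 2 - 1) / c) : ℝ × ℝ) s :=
    h1.prodMk ((h1.sub (hasDerivAt_id s)).div_const c)
  have h2 : HasDerivAt (fun s => Function.uncurry u ((s + η) / 2, ((s + η) / 2 - s) / c)) _ s :=
    HasFDerivAt.comp_hasDerivAt (f := fun s : ℝ => ((s + η) / 2, ((s + η) / 2 - s) / c)) s
      (h.sol.hasFDerivAt hq) hp
  refine h2.congr_deriv ?_
  have e : ((1 / 2, (1 / 2 - 1) / c) : ℝ × ℝ)
      = (1 / 2 : ℝ) • (1, 0) + ((1 / 2 - 1) / c) • (0, 1) := by simp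
  have e1 := h.sol.dx_eq_fderiv h.lt hq
  have e2 := h.sol.dt_eq_fderiv hq
  simp only at e1 e2
  rw [e, map_add, map_smul, map_smul, ← e1, ← e2, flux]
  simp only [smul_eq_mul]
  field_simp
  ring

/-- In the derivative of `2 u - F` the fluxes at the current point and at the entry point are
subtracted, leaving the slice integral of the source; these slices add up to a difference of cone
potentials. The assumption `η ∉ B` prevents the path from running inside a front. -/
theorem leftDefect_eq_of_open_of_lt (h : IsAdmissible c a₁ a₂ G A B u u₀ v₀) {T s₁ s₂ η : ℝ}
    (hs : s₁ < s₂) (hη : η ∉ B)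
    (h₁ : ((s₁ + η) / 2, ((s₁ + η) / 2 - s₁) / c) ∈ openCylinder a₁ a₂)
    (h₂ : ((s₂ + η) / 2, ((s₂ + η) / 2 - s₂) / c) ∈ openCylinder a₁ a₂)
    (hT : ((s₁ + η) / 2 - s₁) / c ≤ T) :
    leftDefect c a₁ a₂ G u u₀ v₀ T ((s₁ + η) / 2, ((s₁ + η) / 2 - s₁) / c)
      = leftDefect c a₁ a₂ G u u₀ v₀ T ((s₂ + η) / 2, ((s₂ + η) / 2 - s₂) / c) := by
  have hc := h.c_pos
  have hcm : ∀ y : ℝ, c * (y / c) = y := fun y => by field_simp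
  have hpos : ∀ {s : ℝ}, 0 < ((s + η) / 2 - s) / c ↔ s < η := by
    intro s
    rw [div_pos_iff_of_pos_right hc]
    constructor <;> intro <;> linarith
  have hs₂η : s₂ < η := hpos.1 h₂.2
  have hT0 : 0 < T := lt_of_lt_of_le h₁.2 hT
  have ha₁ : a₁ < (s₁ + η) / 2 := h₁.1.1
  have ha₂ : (s₂ + η) / 2 < a₂ := h₂.1.2
  have hTs : ∀ s ∈ Icc s₁ s₂, ((s + η) / 2 - s) / c ≤ T := fun s hs => by
    refine le_trans (div_le_div_of_nonneg_right ?_ hc.le) hT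
    linarith [hs.1]
  have hop : ∀ s ∈ Icc s₁ s₂, ((s + η) / 2, ((s + η) / 2 - s) / c) ∈ openCylinder a₁ a₂ :=
    fun s hs => ⟨⟨by linarith [hs.1], by linarith [hs.2]⟩, hpos.2 (by linarith [hs.2])⟩
  set F := leftData c a₁ (dx a₁ a₂ u a₁) (u a₁) u₀ v₀ with hF
  set Φ := source a₁ a₂ G T with hΦ
  have hΦi : Integrable Φ := h.integrable_source T
  set D : ℝ → ℝ := fun s => 2 * u ((s + η) / 2) (((s + η) / 2 - s) / c) - F s with hD
  set D' : ℝ → ℝ := fun s => -(c⁻¹ * (flux c a₁ a₂ u s ((s + η) / 2)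
    - flux c a₁ a₂ u s (max s a₁))) with hD'
  -- Excluded are the `s` on right-moving fronts, those whose entry point lies on a left-moving
  -- front, and the corner `s = a₁`.
  set bad : Set ℝ := A ∪ (fun s => 2 * max s a₁ - s) ⁻¹' B ∪ {a₁} with hbad
  have hbadc : bad.Countable := by
    refine (h.sol.countable_right.union ?_).union (countable_singleton _)
    refine (h.sol.countable_left.union
      (h.sol.countable_left.preimage (f := fun s : ℝ => 2 * a₁ - s)
        fun x y hxy => by simpa using hxy)).mono ?_
    intro s hs
    rcases le_total s a₁ with h1 | h1
    · right; simpa [max_eq_right h1] using hs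
    · left
      have hs' : 2 * max s a₁ - s ∈ B := hs
      rw [max_eq_left h1] at hs'
      convert hs' using 1; ring
  have hfr : ∀ s, s ∉ A → ((s + η) / 2, ((s + η) / 2 - s) / c) ∉ fronts c A B := by
    rintro s hsA (h1 | h1)
    · simp only [hcm] at h1; exact hsA (by convert h1 using 1; ring)
    · simp only [hcm] at h1; exact hη (by convert h1 using 1; ring)
  have hDc : ContinuousOn D (Icc s₁ s₂) := by
    have h1 : ContinuousOn (fun s => u ((s + η) / 2) (((s + η) / 2 - s) / c)) (Icc s₁ s₂) :=
      h.sol.continuousOn.comp (f := fun s : ℝ => ((s + η) / 2, ((s + η) / 2 - s) / c))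
        (by fun_prop) fun s hs => openCylinder_subset_cylinder _ _ (hop s hs)
    refine (continuousOn_const.mul h1).sub ((h.continuousOn_leftData hT0.le).mono fun s hs => ?_)
    have h2 := hTs s hs
    rw [div_le_iff₀ hc] at h2
    have h3 := (hop s hs).1
    exact ⟨by linarith [h3.1], by linarith [hs.2]⟩
  have hDd : ∀ s ∈ Ioo s₁ s₂ \ bad, HasDerivAt D (D' s) s := by
    rintro s ⟨hs, hsb⟩
    simp only [hbad, mem_union, not_or] at hsb
    have hsI := Ioo_subset_Icc_self hs
    have h1 := h.hasDerivAt_along_left ⟨hop s hsI, hfr s hsb.1.1⟩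
    have h2 := h.hasDerivAt_leftData (s := s) (by linarith [hs.2]) hsb.2 hsb.1.1 hsb.1.2
    refine ((h1.const_mul 2).sub h2).congr_deriv ?_
    simp only [hD']
    field_simp
    ring
  -- Only almost everywhere, since Fubini makes the source integrable along almost every
  -- characteristic.
  have hDae : ∀ᵐ s : ℝ, s ∈ Ioo s₁ s₂ → D' s = slice c Φ η s := by
    filter_upwards [ae_integrable_line hc hΦi, hbadc.ae_notMem volume] with s hint hsb hs
    simp only [hbad, mem_union, not_or] at hsb
    have hsI := Ioo_subset_Icc_self hs
    have h1 := h.flux_sub_flux (T := T) (s := s) (e := max s a₁) (z := (s + η) / 2) rfl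
      (max_lt (by linarith [hs.2]) (hop s hsI).1.1) (hop s hsI).1.2 (hTs s hsI) hsb.1.1 hsb.1.2
      (by convert hη using 1; ring_nf) hint
    rw [show 2 * ((s + η) / 2) - s = η by ring] at h1
    simp only [hD']
    rw [h1, ← hΦ]
    field_simp
  have hint : IntervalIntegrable (slice c Φ η) volume s₁ s₂ :=
    (integrable_slice hc hΦi η).intervalIntegrable
  have hae : D' =ᵐ[volume.restrict (Ioc s₁ s₂)] slice c Φ η := by
    rw [← restrict_Ioo_eq_restrict_Ioc]
    exact (ae_restrict_iff' measurableSet_Ioo).2 hDae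
  have hFTC := integral_eq_of_hasDerivAt_off_countable_of_le D D' hs.le hbadc hDc hDd
    (hint.congr_ae (by rw [uIoc_of_le hs.le]; exact hae.symm))
  have hcongr : ∫ s in s₁..s₂, D' s = ∫ s in s₁..s₂, slice c Φ η s :=
    intervalIntegral.integral_congr_ae_restrict (by rw [uIoc_of_le hs.le]; exact hae)
  rw [hcongr, ← potential_sub hc hΦi] at hFTC
  have e1 : ∀ s : ℝ, (s + η) / 2 - c * (((s + η) / 2 - s) / c) = s := fun s => by
    rw [hcm]; ring
  have e2 : ∀ s : ℝ, (s + η) / 2 + c * (((s + η) / 2 - s) / c) = η := fun s => by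
    rw [hcm]; ring
  simp only [leftDefect, e1, e2]
  simp only [hD] at hFTC
  linarith

theorem leftDefect_eq_of_open (h : IsAdmissible c a₁ a₂ G A B u u₀ v₀) {T : ℝ} {p q : ℝ × ℝ}
    (hp : p ∈ openCylinder a₁ a₂) (hq : q ∈ openCylinder a₁ a₂) (hpT : p.2 ≤ T) (hqT : q.2 ≤ T)
    (hpq : p.1 + c * p.2 = q.1 + c * q.2) (hB : p.1 + c * p.2 ∉ B) :
    leftDefect c a₁ a₂ G u u₀ v₀ T p = leftDefect c a₁ a₂ G u u₀ v₀ T q := by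
  have hc := h.c_pos
  have key : ∀ r : ℝ × ℝ, r.1 + c * r.2 = p.1 + c * p.2 →
      ((r.1 - c * r.2 + (p.1 + c * p.2)) / 2,
        ((r.1 - c * r.2 + (p.1 + c * p.2)) / 2 - (r.1 - c * r.2)) / c) = r := by
    intro r hr
    rw [← hr]
    ext
    · simp only; ring
    · simp only; field_simp; ring
  have kp := key p rfl
  have kq := key q hpq.symm
  rcases lt_trichotomy (p.1 - c * p.2) (q.1 - c * q.2) with hlt | heq | hlt
  · have := h.leftDefect_eq_of_open_of_lt (T := T) hlt hB (by rwa [kp]) (by rwa [kq])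
      ((congrArg Prod.snd kp).le.trans hpT)
    rwa [kp, kq] at this
  · congr 1
    ext
    · linarith
    · have : c * p.2 = c * q.2 := by linarith
      exact mul_left_cancel₀ hc.ne' this
  · have := h.leftDefect_eq_of_open_of_lt (T := T) hlt hB (by rwa [kq]) (by rwa [kp])
      ((congrArg Prod.snd kq).le.trans hqT)
    rw [kp, kq] at this
    exact this.symm

theorem continuousOn_leftDefect (h : IsAdmissible c a₁ a₂ G A B u u₀ v₀) {T : ℝ} (hT : 0 ≤ T) :
    ContinuousOn (leftDefect c a₁ a₂ G u u₀ v₀ T) (Icc a₁ a₂ ×ˢ Icc 0 T) := by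
  have hc := h.c_pos
  have h1 : ContinuousOn (fun q : ℝ × ℝ => u q.1 q.2) (Icc a₁ a₂ ×ˢ Icc 0 T) :=
    h.sol.continuousOn.mono (prod_mono_right Icc_subset_Ici_self)
  have h2 : ContinuousOn (fun q : ℝ × ℝ =>
      leftData c a₁ (dx a₁ a₂ u a₁) (u a₁) u₀ v₀ (q.1 - c * q.2)) (Icc a₁ a₂ ×ˢ Icc 0 T) := by
    refine (h.continuousOn_leftData hT).comp (f := fun q : ℝ × ℝ => q.1 - c * q.2)
      (by fun_prop) ?_
    rintro q ⟨hx, ht⟩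
    have e1 := mul_le_mul_of_nonneg_left ht.2 hc.le
    have e2 := mul_nonneg hc.le ht.1
    exact ⟨by linarith [hx.1], by linarith [hx.2]⟩
  have h3 : Continuous (fun q : ℝ × ℝ =>
      potential c (source a₁ a₂ G T) (q.1 - c * q.2) (q.1 + c * q.2)) :=
    (continuous_potential (h.integrable_source T)).comp
      (by fun_prop : Continuous fun q : ℝ × ℝ => (q.1 - c * q.2, q.1 + c * q.2))
  exact ((continuousOn_const.mul h1).sub h2).add (continuousOn_const.mul h3.continuousOn)

/-- Both points are pushed towards one interior point `z` by the same proportion `ε`, so they stay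
on a common characteristic `x + c t = η(ε)`. As `z` lies off the original characteristic, `η(ε)` is
injective and meets `B` for countably many `ε` only; let `ε → 0` through the others. -/
theorem leftDefect_eq (h : IsAdmissible c a₁ a₂ G A B u u₀ v₀) {T : ℝ} (hT : 0 < T) {p q : ℝ × ℝ}
    (hp : p ∈ Icc a₁ a₂ ×ˢ Icc 0 T) (hq : q ∈ Icc a₁ a₂ ×ˢ Icc 0 T)
    (hpq : p.1 + c * p.2 = q.1 + c * q.2) :
    leftDefect c a₁ a₂ G u u₀ v₀ T p = leftDefect c a₁ a₂ G u u₀ v₀ T q := by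
  have hc := h.c_pos
  obtain ⟨z, hz, hzη⟩ : ∃ z ∈ Ioo a₁ a₂ ×ˢ Ioo 0 T, z.1 + c * z.2 ≠ p.1 + c * p.2 := by
    have hm : (a₁ + a₂) / 2 ∈ Ioo a₁ a₂ := ⟨by linarith [h.lt], by linarith [h.lt]⟩
    by_cases h1 : (a₁ + a₂) / 2 + c * (T / 2) = p.1 + c * p.2
    · refine ⟨((a₁ + a₂) / 2, T / 3), ⟨hm, by simp only; constructor <;> linarith⟩, ?_⟩
      simp only
      rw [← h1]
      have : 0 < c * T := mul_pos hc hT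
      intro h2; linarith
    · exact ⟨((a₁ + a₂) / 2, T / 2), ⟨hm, by simp only; constructor <;> linarith⟩, h1⟩
  set γ : ℝ × ℝ → ℝ → ℝ × ℝ := fun r ε => (r.1 + ε * (z.1 - r.1), r.2 + ε * (z.2 - r.2)) with hγ
  have hγc : ∀ r, Continuous (γ r) := fun r => by simp only [hγ]; fun_prop
  have hγ0 : ∀ r, γ r 0 = r := fun r => by simp [hγ]
  have hγm : ∀ r ∈ Icc a₁ a₂ ×ˢ Icc 0 T, ∀ ε ∈ Ioo (0 : ℝ) 1,
      γ r ε ∈ Ioo a₁ a₂ ×ˢ Ioo 0 T := by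
    rintro r ⟨hr1, hr2⟩ ε ⟨h0, h1⟩
    have e : ∀ a x w : ℝ, a ≤ x → a < w → a < x + ε * (w - x) := fun a x w hx hw => by
      nlinarith [mul_pos h0 (sub_pos.2 hw), mul_nonneg (sub_nonneg.2 h1.le) (sub_nonneg.2 hx)]
    have e' : ∀ a x w : ℝ, x ≤ a → w < a → x + ε * (w - x) < a := fun a x w hx hw => by
      nlinarith [mul_pos h0 (sub_pos.2 hw), mul_nonneg (sub_nonneg.2 h1.le) (sub_nonneg.2 hx)]
    exact ⟨⟨e _ _ _ hr1.1 hz.1.1, e' _ _ _ hr1.2 hz.1.2⟩,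
      ⟨e _ _ _ hr2.1 hz.2.1, e' _ _ _ hr2.2 hz.2.2⟩⟩
  set good : Set ℝ := {ε | (γ p ε).1 + c * (γ p ε).2 ∉ B} with hgood
  have hbad : (goodᶜ).Countable := by
    have : (goodᶜ) = (fun ε : ℝ => (γ p ε).1 + c * (γ p ε).2) ⁻¹' B := by ext y; simp [hgood]
    rw [this]
    refine h.sol.countable_left.preimage fun x y hxy => ?_
    simp only [hγ] at hxy
    have h1 : (x - y) * (z.1 + c * z.2 - (p.1 + c * p.2)) = 0 := by linarith
    rcases mul_eq_zero.1 h1 with h2 | h2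
    · linarith
    · exact absurd (by linarith) hzη
  have hdense : Dense good := by simpa using hbad.dense_compl ℝ
  have h0 : (0 : ℝ) ∈ closure (Ioo 0 1 ∩ good) := by
    have h1 : Icc (0 : ℝ) 1 ⊆ closure (Ioo 0 1 ∩ good) := by
      rw [← closure_Ioo zero_ne_one]
      exact closure_minimal (hdense.open_subset_closure_inter isOpen_Ioo) isClosed_closure
    exact h1 (left_mem_Icc.2 zero_le_one)
  have : (𝓝[Ioo 0 1 ∩ good] (0 : ℝ)).NeBot := mem_closure_iff_nhdsWithin_neBot.1 h0
  have hlim : ∀ r ∈ Icc a₁ a₂ ×ˢ Icc 0 T,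
      Tendsto (fun ε => leftDefect c a₁ a₂ G u u₀ v₀ T (γ r ε)) (𝓝[Ioo 0 1 ∩ good] 0)
        (𝓝 (leftDefect c a₁ a₂ G u u₀ v₀ T r)) := by
    intro r hr
    refine Tendsto.comp (h.continuousOn_leftDefect hT.le r hr) (tendsto_nhdsWithin_iff.2 ⟨?_, ?_⟩)
    · have := ((hγc r).tendsto 0).mono_left (nhdsWithin_le_nhds (s := Ioo 0 1 ∩ good))
      rwa [hγ0] at this
    · filter_upwards [self_mem_nhdsWithin] with ε hε
      have := hγm r hr ε hε.1
      exact ⟨Ioo_subset_Icc_self this.1, Ioo_subset_Icc_self this.2⟩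
  refine tendsto_nhds_unique_of_eventuallyEq (hlim p hp) (hlim q hq) ?_
  filter_upwards [self_mem_nhdsWithin] with ε hε
  have hp' := hγm p hp ε hε.1
  have hq' := hγm q hq ε hε.1
  refine h.leftDefect_eq_of_open ⟨hp'.1, hp'.2.1⟩ ⟨hq'.1, hq'.2.1⟩ hp'.2.2.le hq'.2.2.le ?_ hε.2
  simp only [hγ]
  linear_combination (1 - ε) * hpq

/-! ### The representation inside the cylinder. -/

/-- The difference `E` of the two sides is constant along both families of characteristics, because
each of `F`, `F'` depends on one characteristic coordinate only. The constant `c⁻¹ ∫ v₀` makes `E`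
vanish at `t = 0`, where `F` and `F'` carry the integrals of `v₀` over the two complementary parts
of the interval. -/
theorem two_mul_eq (h : IsAdmissible c a₁ a₂ G A B u u₀ v₀) {T : ℝ} (hT : 0 < T) {x t : ℝ}
    (hx : x ∈ Icc a₁ a₂) (ht : t ∈ Icc 0 T) :
    2 * u x t = leftData c a₁ (dx a₁ a₂ u a₁) (u a₁) u₀ v₀ (x - c * t)
      + leftData c (-a₂) (fun τ => - dx a₁ a₂ u a₂ τ) (u a₂) (fun y => u₀ (-y)) (fun y => v₀ (-y))
          (-(x + c * t))
      + c⁻¹ * (∫ y in a₁..a₂, v₀ y)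
      - c * potential c (source a₁ a₂ G T) (x - c * t) (x + c * t) := by
  have hc := h.c_pos
  set F := leftData c a₁ (dx a₁ a₂ u a₁) (u a₁) u₀ v₀ with hF
  set F' := leftData c (-a₂) (fun τ => - dx a₁ a₂ u a₂ τ) (u a₂) (fun y => u₀ (-y))
    (fun y => v₀ (-y)) with hF'
  set P := potential c (source a₁ a₂ G T) with hP
  set K := c⁻¹ * (∫ y in a₁..a₂, v₀ y) with hK
  have hleft : ∀ p q : ℝ × ℝ, p ∈ Icc a₁ a₂ ×ˢ Icc 0 T → q ∈ Icc a₁ a₂ ×ˢ Icc 0 T →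
      p.1 + c * p.2 = q.1 + c * q.2 →
      2 * u p.1 p.2 - F (p.1 - c * p.2) + c * P (p.1 - c * p.2) (p.1 + c * p.2)
        = 2 * u q.1 q.2 - F (q.1 - c * q.2) + c * P (q.1 - c * q.2) (q.1 + c * q.2) :=
    fun p q hp hq hpq => h.leftDefect_eq hT hp hq hpq
  have hright : ∀ p q : ℝ × ℝ, p ∈ Icc a₁ a₂ ×ˢ Icc 0 T → q ∈ Icc a₁ a₂ ×ˢ Icc 0 T →
      p.1 - c * p.2 = q.1 - c * q.2 →
      2 * u p.1 p.2 - F' (-(p.1 + c * p.2)) + c * P (p.1 - c * p.2) (p.1 + c * p.2)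
        = 2 * u q.1 q.2 - F' (-(q.1 + c * q.2)) + c * P (q.1 - c * q.2) (q.1 + c * q.2) := by
    have hdata : F' = leftData c (-a₂) (dx (-a₂) (-a₁) (fun x t => u (-x) t) (-a₂))
        (fun t => u (- -a₂) t) (fun y => u₀ (-y)) (fun y => v₀ (-y)) := by
      rw [hF']
      congr 1
      · ext τ; rw [dx_reflect, neg_neg]
      · rw [neg_neg]
    have hdef : ∀ p : ℝ × ℝ, leftDefect c (-a₂) (-a₁) (fun x t => G (-x) t) (fun x t => u (-x) t)
        (fun y => u₀ (-y)) (fun y => v₀ (-y)) T (-p.1, p.2)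
        = 2 * u p.1 p.2 - F' (-(p.1 + c * p.2)) + c * P (p.1 - c * p.2) (p.1 + c * p.2) := by
      intro p
      rw [leftDefect, source_reflect, hdata, hP,
        ← potential_reflect c (source a₁ a₂ G T) (p.1 - c * p.2) (p.1 + c * p.2)]
      simp only [neg_neg]
      rw [show -p.1 - c * p.2 = -(p.1 + c * p.2) by ring,
        show -p.1 + c * p.2 = -(p.1 - c * p.2) by ring]
    intro p q hp hq hpq
    rw [← hdef, ← hdef]
    refine h.reflect.leftDefect_eq hT ⟨⟨neg_le_neg hp.1.2, neg_le_neg hp.1.1⟩, hp.2⟩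
      ⟨⟨neg_le_neg hq.1.2, neg_le_neg hq.1.1⟩, hq.2⟩ ?_
    simp only
    linarith
  set E : ℝ → ℝ → ℝ := fun x t =>
    2 * u x t - F (x - c * t) - F' (-(x + c * t)) + c * P (x - c * t) (x + c * t) - K with hE
  have hEleft : ∀ x t x' t', x ∈ Icc a₁ a₂ → t ∈ Icc 0 T → x' ∈ Icc a₁ a₂ → t' ∈ Icc 0 T →
      x + c * t = x' + c * t' → E x t = E x' t' := by
    intro x t x' t' hx ht hx' ht' he
    have := hleft (x, t) (x', t') ⟨hx, ht⟩ ⟨hx', ht'⟩ he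
    simp only at this
    simp only [hE]
    rw [he] at this ⊢
    linarith
  have hEright : ∀ x t x' t', x ∈ Icc a₁ a₂ → t ∈ Icc 0 T → x' ∈ Icc a₁ a₂ → t' ∈ Icc 0 T →
      x - c * t = x' - c * t' → E x t = E x' t' := by
    intro x t x' t' hx ht hx' ht' he
    have := hright (x, t) (x', t') ⟨hx, ht⟩ ⟨hx', ht'⟩ he
    simp only at this
    simp only [hE]
    rw [he] at this ⊢
    linarith
  have hbase : ∀ x ∈ Icc a₁ a₂, E x 0 = 0 := by
    intro x hx
    have hpot : P x x = 0 := by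
      rw [hP, potential]
      refine setIntegral_eq_zero_of_forall_eq_zero fun q hq => indicator_of_notMem ?_ _
      rintro ⟨_, h2⟩
      have := mul_nonneg hc.le h2.1
      linarith [hq.1, hq.2]
    have e1 : F x = u₀ x - c⁻¹ * ∫ y in a₁..x, v₀ y := by
      rcases hx.1.eq_or_lt with rfl | hlt
      · simp [hF, leftData, h.init.value _ hx]
      · simp [hF, leftData, hlt]
    have e2 : F' (-x) = u₀ x - c⁻¹ * ∫ y in x..a₂, v₀ y := by
      rcases hx.2.eq_or_lt with rfl | hlt
      · simp [hF', leftData, h.init.value _ hx]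
      · simp [hF', leftData, hlt]
    have e3 : (∫ y in a₁..x, v₀ y) + ∫ y in x..a₂, v₀ y = ∫ y in a₁..a₂, v₀ y := by
      have hi := h.integrable_velocity
      have hle := h.lt.le
      refine intervalIntegral.integral_add_adjacent_intervals (hi.mono_set ?_) (hi.mono_set ?_)
      · rw [uIcc_of_le hx.1, uIcc_of_le hle]; exact Icc_subset_Icc_right hx.2
      · rw [uIcc_of_le hx.2, uIcc_of_le hle]; exact Icc_subset_Icc_left hx.1
    simp only [hE, mul_zero, sub_zero, add_zero, hpot, e1, e2, h.init.value x hx, hK, ← e3]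
    ring
  have hd : 0 < (a₂ - a₁) / c := div_pos (sub_pos.2 h.lt) hc
  have ha₁ : a₁ ∈ Icc a₁ a₂ := left_mem_Icc.2 h.lt.le
  have ha₂ : a₂ ∈ Icc a₁ a₂ := right_mem_Icc.2 h.lt.le
  have hfromleft : ∀ t ∈ Icc 0 T, E a₁ t = if t ≤ (a₂ - a₁) / c then 0
      else E a₂ (t - (a₂ - a₁) / c) := by
    intro t ht
    split_ifs with hle
    · have hct : c * t ≤ a₂ - a₁ := by rwa [le_div_iff₀ hc, mul_comm] at hle
      have hxm : a₁ + c * t ∈ Icc a₁ a₂ := ⟨by nlinarith [ht.1], by linarith⟩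
      rw [hEleft a₁ t (a₁ + c * t) 0 ha₁ ht hxm ⟨le_rfl, hT.le⟩ (by ring)]
      exact hbase _ hxm
    · refine hEleft _ _ _ _ ha₁ ht ha₂ ⟨by linarith, by linarith [ht.2]⟩ ?_
      field_simp; ring
  have hfromright : ∀ t ∈ Icc 0 T, E a₂ t = if t ≤ (a₂ - a₁) / c then 0
      else E a₁ (t - (a₂ - a₁) / c) := by
    intro t ht
    split_ifs with hle
    · have hct : c * t ≤ a₂ - a₁ := by rwa [le_div_iff₀ hc, mul_comm] at hle
      have hxm : a₂ - c * t ∈ Icc a₁ a₂ := ⟨by linarith, by nlinarith [ht.1]⟩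
      rw [hEright a₂ t (a₂ - c * t) 0 ha₂ ht hxm ⟨le_rfl, hT.le⟩ (by ring)]
      exact hbase _ hxm
    · refine hEright _ _ _ _ ha₂ ht ha₁ ⟨by linarith, by linarith [ht.2]⟩ ?_
      field_simp; ring
  -- Each crossing of the interval takes time `(a₂ - a₁) / c` and exchanges the walls, so both walls
  -- are treated in one induction.
  have hbdry : ∀ n : ℕ, ∀ t ∈ Icc 0 T, t ≤ n * ((a₂ - a₁) / c) → E a₁ t = 0 ∧ E a₂ t = 0 := by
    intro n
    induction n with
    | zero =>
      intro t ht hn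
      have : t = 0 := le_antisymm (by simpa using hn) ht.1
      subst this
      exact ⟨hbase _ ha₁, hbase _ ha₂⟩
    | succ n ih =>
      intro t ht hn
      rw [hfromleft t ht, hfromright t ht]
      split_ifs with hle
      · exact ⟨rfl, rfl⟩
      · push Not at hle
        push_cast at hn
        exact (ih (t - (a₂ - a₁) / c) ⟨by linarith, by linarith [ht.2]⟩ (by linarith)).symm
  -- Backwards along the right-moving characteristic one meets either the initial line or the left
  -- wall.
  have hEzero : E x t = 0 := by
    by_cases hle : c * t ≤ x - a₁
    · have hxm : x - c * t ∈ Icc a₁ a₂ := ⟨by linarith, by nlinarith [ht.1, hx.2]⟩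
      rw [hEright x t (x - c * t) 0 hx ht hxm ⟨le_rfl, hT.le⟩ (by ring)]
      exact hbase _ hxm
    · push Not at hle
      have ht' : t - (x - a₁) / c ∈ Icc 0 T := by
        have h1 : (x - a₁) / c < t := by rw [div_lt_iff₀ hc]; linarith
        have h2 : 0 ≤ (x - a₁) / c := div_nonneg (by linarith [hx.1]) hc.le
        exact ⟨by linarith, by linarith [ht.2]⟩
      rw [hEright x t a₁ (t - (x - a₁) / c) hx ht ha₁ ht' (by field_simp; ring)]
      obtain ⟨n, hn⟩ := exists_nat_ge ((t - (x - a₁) / c) / ((a₂ - a₁) / c))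
      exact (hbdry n _ ht' (by rwa [div_le_iff₀ hd] at hn)).1
  simp only [hE] at hEzero
  linarith

end IsAdmissible

/-! ### Evaluation of the endpoint terms in each region. -/

/-- The contribution of the left endpoint `a` and of the right-moving initial data to the
representation formula on the interval `(a, b)`. -/
noncomputable def sideTerm (c a b : ℝ) (p q u₀ v₀ : ℝ → ℝ) (x t : ℝ) : ℝ :=
  Real.sign (x - a) * heaviside (c * t - |x - a|) * q (t - |x - a| / c)
    - c * (heaviside (c * t - |x - a|) * ∫ τ in (|x - a| / c)..t, p (t - τ))
    + u₀ (x - c * t) * charInterval a b (x - c * t)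
    - c⁻¹ * ∫ y in a..max a (min b (x - c * t)), v₀ y

section sideTerm

variable {c a b : ℝ} {p q u₀ v₀ : ℝ → ℝ} {x t : ℝ}

theorem charInterval_of_mem (h : x ∈ Ioo a b) : charInterval a b x = 1 := by
  rw [charInterval, heaviside_of_pos (by linarith [h.1]), heaviside_of_pos (by linarith [h.2]),
    one_mul]

theorem charInterval_of_lt (h : x < a) : charInterval a b x = 0 := by
  rw [charInterval, heaviside_of_neg (by linarith), zero_mul]

theorem charInterval_of_gt (h : b < x) : charInterval a b x = 0 := by
  rw [charInterval, heaviside_of_neg (s := b - x) (by linarith), mul_zero]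

theorem charInterval_left (hab : a < b) : charInterval a b a = 1 / 2 := by
  rw [charInterval, sub_self, heaviside_zero, heaviside_of_pos (by linarith), mul_one]

theorem charInterval_right (hab : a < b) : charInterval a b b = 1 / 2 := by
  rw [charInterval, sub_self, heaviside_zero, heaviside_of_pos (by linarith), one_mul]

theorem charInterval_neg (a b x : ℝ) : charInterval (-b) (-a) (-x) = charInterval a b x := by
  rw [charInterval, charInterval, mul_comm, show -a - -x = x - a by ring,
    show -x - -b = b - x by ring]

theorem integral_delayed (p : ℝ → ℝ) (s t : ℝ) :
    ∫ τ in s..t, p (t - τ) = ∫ τ in (0 : ℝ)..(t - s), p τ := by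
  rw [intervalIntegral.integral_comp_sub_left p t, sub_self]

/-- On the front `x - c t = a` the wall term and the initial term each count one half; `hq` makes
the halves add up. -/
theorem sideTerm_of_gt (hc : 0 < c) (hab : a < b) (hq : q 0 = u₀ a) (hx : a < x)
    (hξ : x - c * t < b) : sideTerm c a b p q u₀ v₀ x t = leftData c a p q u₀ v₀ (x - c * t) := by
  have habs : |x - a| = x - a := abs_of_pos (by linarith)
  have hdel : t - (x - a) / c = (a - (x - c * t)) / c := by field_simp; ring
  rw [sideTerm, habs, Real.sign_of_pos (by linarith), integral_delayed, hdel]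
  rcases lt_trichotomy (x - c * t) a with h | h | h
  · rw [heaviside_of_pos (by linarith), charInterval_of_lt h, min_eq_right (by linarith),
      max_eq_left h.le, leftData, if_neg h.not_gt]
    simp
  · rw [h, show c * t - (x - a) = 0 by linarith, heaviside_zero, charInterval_left hab,
      min_eq_right hab.le, max_self, leftData, if_neg (lt_irrefl a)]
    simp [hq]
    ring
  · rw [heaviside_of_neg (by linarith), charInterval_of_mem ⟨h, hξ⟩, min_eq_right hξ.le,
      max_eq_right h.le, leftData, if_pos h]
    simp

theorem sideTerm_self (hc : 0 < c) (hab : a < b) (ht : 0 < t) :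
    sideTerm c a b p q u₀ v₀ a t = leftData c a p q u₀ v₀ (a - c * t) - q t := by
  have hct := mul_pos hc ht
  have hdel : (a - (a - c * t)) / c = t := by field_simp; ring
  rw [sideTerm, integral_delayed, sub_self, abs_zero, zero_div, sub_zero, sub_zero,
    heaviside_of_pos hct, charInterval_of_lt (by linarith), min_eq_right (by linarith),
    max_eq_left (by linarith), leftData, if_neg (by linarith), hdel]
  simp

/-- Outside, the sign in front of `q` is reversed, which costs `2 q` compared with `leftData`. This
is what cancels `2 u` on the wall. -/
theorem sideTerm_of_lt (hc : 0 < c) (hab : a < b) (hx : x < a) (hη : a < x + c * t) :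
    sideTerm c a b p q u₀ v₀ x t
      = leftData c a p q u₀ v₀ (2 * a - (x + c * t)) - 2 * q ((x + c * t - a) / c) := by
  have habs : |x - a| = a - x := by rw [abs_of_neg (by linarith)]; ring
  have hdel : t - (a - x) / c = (x + c * t - a) / c := by field_simp; ring
  have hdel' : a - (2 * a - (x + c * t)) = x + c * t - a := by ring
  rw [sideTerm, habs, Real.sign_of_neg (by linarith), integral_delayed, hdel,
    heaviside_of_pos (by linarith), charInterval_of_lt (by linarith), min_eq_right (by linarith),
    max_eq_left (by linarith), leftData, if_neg (by linarith), hdel']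
  simp
  ring

/-- The remaining half of the corner value is to cancel the half value that `charInterval` gives to
the initial term of the opposite side. -/
theorem sideTerm_of_outgoing_front (hc : 0 < c) (hab : a < b) (ht : 0 < t) (hη : x + c * t = a) :
    sideTerm c a b p q u₀ v₀ x t = -(q 0 / 2) := by
  have hct := mul_pos hc ht
  have habs : |x - a| = c * t := by rw [abs_of_neg (by linarith)]; linarith
  have hdel : c * t / c = t := by field_simp
  rw [sideTerm, habs, Real.sign_of_neg (by linarith), integral_delayed, hdel, sub_self, sub_self,
    heaviside_zero, charInterval_of_lt (by linarith), min_eq_right (by linarith),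
    max_eq_left (by linarith)]
  simp
  ring

theorem sideTerm_of_unreached (hab : a < b) (ht : 0 < c * t) (hη : x + c * t < a) :
    sideTerm c a b p q u₀ v₀ x t = 0 := by
  have habs : |x - a| = a - x := by rw [abs_of_neg (by linarith)]; ring
  rw [sideTerm, habs, heaviside_of_neg (by linarith), charInterval_of_lt (by linarith),
    min_eq_right (by linarith), max_eq_left (by linarith)]
  simp

theorem sideTerm_of_ge_right (hab : a < b) (ht : 0 < c * t) (hξ : b ≤ x - c * t) :
    sideTerm c a b p q u₀ v₀ x t
      = u₀ (x - c * t) * charInterval a b (x - c * t) - c⁻¹ * ∫ y in a..b, v₀ y := by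
  have habs : |x - a| = x - a := abs_of_pos (by linarith)
  rw [sideTerm, habs, heaviside_of_neg (by linarith), min_eq_left hξ, max_eq_right hab.le]
  simp

end sideTerm

/-- Where `y ≤ a₂` and `y - c τ > ξ`, automatically `y + c τ < 2 a₂ - ξ`, so the upper bound of the
cone is not felt. -/
theorem potential_source_congr {c a₁ a₂ : ℝ} (G : ℝ → ℝ → ℝ) (T : ℝ) {ξ η η' : ℝ}
    (hη : 2 * a₂ - ξ ≤ η) (hη' : 2 * a₂ - ξ ≤ η') :
    potential c (source a₁ a₂ G T) ξ η = potential c (source a₁ a₂ G T) ξ η' := by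
  rw [potential, potential, ← integral_indicator (measurableSet_cone _ _ _),
    ← integral_indicator (measurableSet_cone _ _ _)]
  congr 1
  ext q
  by_cases hq : q ∈ Icc a₁ a₂ ×ˢ Icc 0 T
  · have hiff : q ∈ cone c ξ η ↔ q ∈ cone c ξ η' := by
      simp only [cone, mem_ofPred_eq]
      constructor <;> rintro ⟨h1, h2⟩ <;> exact ⟨h1, by linarith [hq.1.2]⟩
    by_cases hm : q ∈ cone c ξ η
    · rw [indicator_of_mem hm, indicator_of_mem (hiff.1 hm)]
    · rw [indicator_of_notMem hm, indicator_of_notMem fun h => hm (hiff.2 h)]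
  · have h0 : source a₁ a₂ G T q = 0 := indicator_of_notMem hq _
    rw [indicator_apply_eq_zero.2 fun _ => h0, indicator_apply_eq_zero.2 fun _ => h0]

theorem potential_source_eq_zero {c a₁ a₂ : ℝ} (hc : 0 < c) (G : ℝ → ℝ → ℝ) (T : ℝ) {ξ : ℝ}
    (hξ : a₂ ≤ ξ) (η : ℝ) : potential c (source a₁ a₂ G T) ξ η = 0 := by
  refine setIntegral_eq_zero_of_forall_eq_zero fun q hq => indicator_of_notMem ?_ _
  rintro ⟨h1, h2⟩
  have := mul_nonneg hc.le h2.1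
  linarith [hq.1, h1.2]

/-- The base of the cone is the whole interval less two tails, clamped to `[a₁, a₂]`; each
`sideTerm` carries one tail. -/
theorem integral_mul_heaviside {c a₁ a₂ x t : ℝ} (ha : a₁ ≤ a₂) (ht : 0 ≤ c * t) (v : ℝ → ℝ)
    (hv : IntervalIntegrable v volume a₁ a₂) :
    ∫ y in a₁..a₂, v y * heaviside (c * t - |x - y|)
      = (∫ y in a₁..a₂, v y) - (∫ y in a₁..max a₁ (min a₂ (x - c * t)), v y)
        - ∫ y in (-a₂)..max (-a₂) (min (-a₁) (-x - c * t)), v (-y) := by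
  set l := max a₁ (min a₂ (x - c * t)) with hl
  set r := min a₂ (max a₁ (x + c * t)) with hr
  have hneg : max (-a₂) (min (-a₁) (-x - c * t)) = -r := by
    rw [hr, show -x - c * t = -(x + c * t) by ring, min_neg_neg, max_neg_neg]
  have hl1 : a₁ ≤ l := le_max_left _ _
  have hr2 : r ≤ a₂ := min_le_left _ _
  have hlr : l ≤ r := by
    refine max_le (le_min ha (le_max_left _ _)) (le_min (min_le_left _ _) ?_)
    exact (min_le_right _ _).trans ((by linarith : x - c * t ≤ x + c * t).trans (le_max_right _ _))
  have hmid : ∫ y in a₁..a₂, v y * heaviside (c * t - |x - y|) = ∫ y in l..r, v y := by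
    rw [intervalIntegral.integral_of_le ha, intervalIntegral.integral_of_le hlr,
      ← integral_indicator measurableSet_Ioc, ← integral_indicator measurableSet_Ioc]
    apply integral_congr_ae
    filter_upwards [Measure.ae_ne volume (x - c * t), Measure.ae_ne volume (x + c * t)]
      with y hy1 hy2
    by_cases hy : y ∈ Ioc l r
    · have hya : y ∈ Ioc a₁ a₂ := ⟨hl1.trans_lt hy.1, hy.2.trans hr2⟩
      rw [indicator_of_mem hy, indicator_of_mem hya, heaviside_of_pos, mul_one]
      have h1 : x - c * t < y := by
        rcases min_lt_iff.1 ((le_max_right _ _).trans_lt hy.1) with h | h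
        · linarith [hya.2]
        · exact h
      have h2 : y ≤ x + c * t := by
        rcases le_max_iff.1 (hy.2.trans (min_le_right _ _)) with h | h
        · linarith [hya.1]
        · exact h
      rw [sub_pos, abs_lt]
      have := lt_of_le_of_ne h2 hy2
      constructor <;> linarith
    · rw [indicator_of_notMem hy]
      refine indicator_apply_eq_zero.2 fun hya => ?_
      rw [heaviside_of_neg, mul_zero]
      by_contra hcon
      have h1 := abs_le.1 (not_lt.1 fun h : c * t < |x - y| => hcon (by linarith))
      refine hy ⟨max_lt hya.1 (min_lt_iff.2 (Or.inr ?_)), le_min hya.2 (le_max_iff.2 (Or.inr ?_))⟩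
      · exact lt_of_le_of_ne (by linarith) (Ne.symm hy1)
      · linarith
  have hsub : ∀ {z w : ℝ}, z ∈ Icc a₁ a₂ → w ∈ Icc a₁ a₂ → IntervalIntegrable v volume z w :=
    fun hz hw => hv.mono_set (by rw [uIcc_of_le ha]; exact uIcc_subset_Icc hz hw)
  have m1 : a₁ ∈ Icc a₁ a₂ := left_mem_Icc.2 ha
  have m2 : a₂ ∈ Icc a₁ a₂ := right_mem_Icc.2 ha
  have ml : l ∈ Icc a₁ a₂ := ⟨hl1, hlr.trans hr2⟩
  have mr : r ∈ Icc a₁ a₂ := ⟨hl1.trans hlr, hr2⟩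
  rw [hneg, intervalIntegral.integral_comp_neg, neg_neg, neg_neg, hmid,
    ← intervalIntegral.integral_add_adjacent_intervals (hsub m1 ml) (hsub ml m2),
    ← intervalIntegral.integral_add_adjacent_intervals (hsub ml mr) (hsub mr m2)]
  ring

/-! ### The representation of the cut-off solution on the whole line. -/

namespace IsAdmissible

variable {c a₁ a₂ : ℝ} {G : ℝ → ℝ → ℝ} {A B : Set ℝ} {u : ℝ → ℝ → ℝ} {u₀ v₀ : ℝ → ℝ}

/-- For `x > a₂` with `x - c t < a₂`, the right-moving characteristic through `(x, t)` leaves the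
cylinder at `(a₂, s)`, and the interior formula at that point shows that the right-hand side is
zero. -/
theorem two_mul_cutoff_of_gt (h : IsAdmissible c a₁ a₂ G A B u u₀ v₀) {x t : ℝ} (ht : 0 < t)
    (hx : a₁ < x) :
    2 * cutoff a₁ a₂ u x t = sideTerm c a₁ a₂ (dx a₁ a₂ u a₁) (u a₁) u₀ v₀ x t
      + sideTerm c (-a₂) (-a₁) (fun τ => - dx a₁ a₂ u a₂ τ) (u a₂) (fun y => u₀ (-y))
          (fun y => v₀ (-y)) (-x) t
      + c⁻¹ * (∫ y in a₁..a₂, v₀ y)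
      - c * potential c (source a₁ a₂ G t) (x - c * t) (x + c * t) := by
  have hc := h.c_pos
  have ha := h.lt
  have ha' : -a₂ < -a₁ := neg_lt_neg ha
  have hct : 0 < c * t := mul_pos hc ht
  have hq₁ : u a₁ 0 = u₀ a₁ := h.init.value _ (left_mem_Icc.2 ha.le)
  have hq₂ : u a₂ 0 = u₀ a₂ := h.init.value _ (right_mem_Icc.2 ha.le)
  have hq₂' : u a₂ 0 = u₀ (- -a₂) := by rw [neg_neg, hq₂]
  have htm : t ∈ Icc 0 t := right_mem_Icc.2 ht.le
  rw [cutoff, heaviside_of_pos ht, mul_one]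
  rcases lt_trichotomy x a₂ with hx2 | rfl | hx2
  · rw [charInterval_of_mem ⟨hx, hx2⟩, mul_one, h.two_mul_eq ht ⟨hx.le, hx2.le⟩ htm,
      sideTerm_of_gt hc ha hq₁ hx (by linarith),
      sideTerm_of_gt (x := -x) hc ha' hq₂' (by linarith) (by linarith), neg_add']
  · have h2 := h.two_mul_eq ht ⟨hx.le, le_rfl⟩ htm
    rw [charInterval_right hx, sideTerm_of_gt hc ha hq₁ hx (by linarith),
      sideTerm_self hc ha' ht, ← neg_add']
    linarith
  · rw [charInterval_of_gt hx2]
    rcases lt_trichotomy (x - c * t) a₂ with hξ | hξ | hξ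
    · set s := (a₂ - (x - c * t)) / c with hs
      have hcs : c * s = a₂ - (x - c * t) := by rw [hs]; field_simp
      have hs0 : 0 ≤ s := div_nonneg (by linarith) hc.le
      have hst : s ≤ t := by rw [hs, div_le_iff₀ hc]; linarith
      have h2 := h.two_mul_eq ht (right_mem_Icc.2 ha.le) ⟨hs0, hst⟩
      rw [sideTerm_of_gt hc ha hq₁ hx hξ, sideTerm_of_lt hc ha' (by linarith) (by linarith),
        show (-x + c * t - -a₂) / c = s by rw [hs]; ring,
        show 2 * -a₂ - (-x + c * t) = -(a₂ + c * s) by rw [hcs]; ring,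
        potential_source_congr G t (η := x + c * t) (η' := a₂ + c * s) (by linarith)
          (by linarith)]
      rw [show a₂ - c * s = x - c * t by rw [hcs]; ring] at h2
      linarith
    · rw [sideTerm_of_ge_right ha hct hξ.ge, sideTerm_of_outgoing_front hc ha' ht (by linarith),
        potential_source_eq_zero hc G t hξ.ge, hξ, charInterval_right ha, hq₂]
      ring
    · rw [sideTerm_of_ge_right ha hct hξ.le, sideTerm_of_unreached ha' hct (by linarith),
        potential_source_eq_zero hc G t hξ.le, charInterval_of_gt hξ]
      ring

theorem two_mul_cutoff (h : IsAdmissible c a₁ a₂ G A B u u₀ v₀) {x t : ℝ} (ht : 0 < t) :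
    2 * cutoff a₁ a₂ u x t = sideTerm c a₁ a₂ (dx a₁ a₂ u a₁) (u a₁) u₀ v₀ x t
      + sideTerm c (-a₂) (-a₁) (fun τ => - dx a₁ a₂ u a₂ τ) (u a₂) (fun y => u₀ (-y))
          (fun y => v₀ (-y)) (-x) t
      + c⁻¹ * (∫ y in a₁..a₂, v₀ y)
      - c * potential c (source a₁ a₂ G t) (x - c * t) (x + c * t) := by
  rcases lt_or_ge a₁ x with hx | hx
  · exact h.two_mul_cutoff_of_gt ht hx
  · have h1 := h.reflect.two_mul_cutoff_of_gt (x := -x) ht (by linarith [h.lt])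
    have e1 : cutoff (-a₂) (-a₁) (fun x t => u (-x) t) (-x) t = cutoff a₁ a₂ u x t := by
      rw [cutoff, cutoff, charInterval_neg, neg_neg]
    have e2 : dx (-a₂) (-a₁) (fun x t => u (-x) t) (-a₂) = fun τ => - dx a₁ a₂ u a₂ τ := by
      ext τ; rw [dx_reflect, neg_neg]
    have e3 : (fun τ => - dx (-a₂) (-a₁) (fun x t => u (-x) t) (-a₁) τ) = dx a₁ a₂ u a₁ := by
      ext τ; rw [dx_reflect, neg_neg, neg_neg]
    rw [e1, e2, e3, source_reflect, show -x - c * t = -(x + c * t) by ring,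
      show -x + c * t = -(x - c * t) by ring, potential_reflect,
      intervalIntegral.integral_comp_neg] at h1
    simp only [neg_neg] at h1
    rw [h1]
    ring

end IsAdmissible
end Wave1D

/-! ### Representation formula and delay equations. -/

theorem mainTheorem4 (c a₁ a₂ : ℝ) (hc : 0 < c) (ha : a₁ < a₂)
    (G : ℝ → ℝ → ℝ)
    (hG : LocallyIntegrableOn (Function.uncurry G) (Wave1D.cylinder a₁ a₂))
    (A B : Set ℝ) (u : ℝ → ℝ → ℝ) (u₀ v₀ : ℝ → ℝ)
    (hu : Wave1D.IsClassicalSolution c a₁ a₂ G A B u)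
    (hinit : Wave1D.HasInitialData c a₁ a₂ A B u u₀ v₀)
    (hv₀ : IntervalIntegrable v₀ volume a₁ a₂)
    (hux₁ : ∀ T : ℝ, 0 < T →
      IntervalIntegrable (fun τ => Wave1D.dx a₁ a₂ u a₁ τ) volume 0 T)
    (hux₂ : ∀ T : ℝ, 0 < T →
      IntervalIntegrable (fun τ => Wave1D.dx a₁ a₂ u a₂ τ) volume 0 T) :
    -- the integral representation of the solution
    (∀ x t : ℝ, 0 < t →
      2 * Wave1D.cutoff a₁ a₂ u x t =
        c * (Wave1D.heaviside (c * t - |x - a₂|) *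
              (∫ τ in (|x - a₂| / c)..t, Wave1D.dx a₁ a₂ u a₂ (t - τ))
            - Wave1D.heaviside (c * t - |x - a₁|) *
              (∫ τ in (|x - a₁| / c)..t, Wave1D.dx a₁ a₂ u a₁ (t - τ)))
        + Real.sign (x - a₁) * Wave1D.heaviside (c * t - |x - a₁|) * u a₁ (t - |x - a₁| / c)
        - Real.sign (x - a₂) * Wave1D.heaviside (c * t - |x - a₂|) * u a₂ (t - |x - a₂| / c)
        + c⁻¹ * (∫ y in a₁..a₂, v₀ y * Wave1D.heaviside (c * t - |x - y|))
        + u₀ (x + c * t) * Wave1D.charInterval a₁ a₂ (x + c * t)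
        + u₀ (x - c * t) * Wave1D.charInterval a₁ a₂ (x - c * t)
        - c * (∫ τ in (0 : ℝ)..t, ∫ y in a₁..a₂,
              Wave1D.heaviside (c * (t - τ) - |x - y|) * G y τ)) ∧
    -- the functional equation with delayed argument at the left endpoint
    (∀ t : ℝ, 0 < t →
      u a₁ t =
        c * Wave1D.heaviside (c * t - (a₂ - a₁)) *
            (∫ τ in ((a₂ - a₁) / c)..t, Wave1D.dx a₁ a₂ u a₂ (t - τ))
        - c * (∫ τ in (0 : ℝ)..t, Wave1D.dx a₁ a₂ u a₁ τ)
        + Wave1D.heaviside (c * t - (a₂ - a₁)) * u a₂ (t - (a₂ - a₁) / c)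
        + c⁻¹ * (∫ y in a₁..a₂, v₀ y * Wave1D.heaviside (c * t - |a₁ - y|))
        + u₀ (a₁ + c * t) * Wave1D.heaviside ((a₂ - a₁) - c * t)
        - c * (∫ τ in (0 : ℝ)..t, ∫ y in a₁..a₂,
              Wave1D.heaviside (c * (t - τ) - |a₁ - y|) * G y τ)) ∧
    -- the functional equation with delayed argument at the right endpoint
    (∀ t : ℝ, 0 < t →
      u a₂ t =
        c * (∫ τ in (0 : ℝ)..t, Wave1D.dx a₁ a₂ u a₂ τ)
        - c * Wave1D.heaviside (c * t - (a₂ - a₁)) *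
            (∫ τ in ((a₂ - a₁) / c)..t, Wave1D.dx a₁ a₂ u a₁ (t - τ))
        + Wave1D.heaviside (c * t - (a₂ - a₁)) * u a₁ (t - (a₂ - a₁) / c)
        + c⁻¹ * (∫ y in a₁..a₂, v₀ y * Wave1D.heaviside (c * t - |a₂ - y|))
        + u₀ (a₂ - c * t) * Wave1D.heaviside ((a₂ - a₁) - c * t)
        - c * (∫ τ in (0 : ℝ)..t, ∫ y in a₁..a₂,
              Wave1D.heaviside (c * (t - τ) - |a₂ - y|) * G y τ)) := by
  open Wave1D in
  have hsource : ∀ T, Integrable (source a₁ a₂ G T) := by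
    intro T
    refine (integrable_indicator_iff (measurableSet_Icc.prod measurableSet_Icc)).2 ?_
    exact hG.integrableOn_compact_subset (prod_mono_right Icc_subset_Ici_self)
      (isCompact_Icc.prod isCompact_Icc)
  have h : IsAdmissible c a₁ a₂ G A B u u₀ v₀ :=
    ⟨hc, ha, hsource, hu, hinit, hv₀, hux₁, hux₂⟩
  refine (fun hrep => ⟨hrep, fun t ht => ?_, fun t ht => ?_⟩) ?_
  · intro x t ht
    have hct := mul_pos hc ht
    rw [h.two_mul_cutoff ht, integral_mul_heaviside ha.le hct.le v₀ hv₀,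
      integral_heaviside_eq_potential ha.le ht.le G x (hsource t), sideTerm, sideTerm,
      show -x - -a₂ = -(x - a₂) by ring, Real.sign_neg, abs_neg,
      intervalIntegral.integral_neg]
    simp only [show -x - c * t = -(x + c * t) by ring, charInterval_neg, neg_neg, source]
    ring
  -- At the endpoint the cut-off is one half, so the left side is `u a₁ t`, while `Real.sign 0 = 0`
  -- removes the same value from the right.
  · have h1 := hrep a₁ t ht
    have hct := mul_pos hc ht
    rw [cutoff, charInterval_left ha, heaviside_of_pos ht, sub_self, abs_zero, sub_zero, zero_div,
      integral_delayed, integral_delayed, abs_of_neg (by linarith : a₁ - a₂ < 0),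
      Real.sign_of_neg (by linarith : a₁ - a₂ < 0), Real.sign_zero, heaviside_of_pos hct,
      charInterval_of_lt (by linarith : a₁ - c * t < a₁), neg_sub] at h1
    have e : charInterval a₁ a₂ (a₁ + c * t) = heaviside ((a₂ - a₁) - c * t) := by
      rw [charInterval, heaviside_of_pos (by linarith), one_mul]
      congr 1; ring
    rw [e, sub_zero] at h1
    rw [integral_delayed]
    linarith
  · have h1 := hrep a₂ t ht
    have hct := mul_pos hc ht
    rw [cutoff, charInterval_right ha, heaviside_of_pos ht, sub_self, abs_zero, sub_zero, zero_div,
      integral_delayed, integral_delayed, abs_of_pos (by linarith : 0 < a₂ - a₁),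
      Real.sign_of_pos (by linarith : 0 < a₂ - a₁), Real.sign_zero, heaviside_of_pos hct,
      charInterval_of_gt (by linarith : a₂ < a₂ + c * t)] at h1
    have e : charInterval a₁ a₂ (a₂ - c * t) = heaviside ((a₂ - a₁) - c * t) := by
      rw [charInterval, heaviside_of_pos (s := a₂ - (a₂ - c * t)) (by linarith), mul_one]
      congr 1; ring
    rw [e, sub_zero] at h1
    rw [integral_delayed]
    linarith
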